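/- For integers $d\ge 1$, $k\ge 2$ and a finite set $A\subset\mathbb{Z}^d$, let \[ P_k(A) := \big|\big\{(a,h_1,\ldots,h_k)\in(\mathbb{Z}^d)^{k+1} : a+\epsilon_1h_1+\cdots+\epsilon_kh_k\in A \text{ for every } (\epsilon_1,\ldots,\epsilon_k)\in\{0,1\}^k\big\}\big|. \] For integers $k,n\ge 2$, let $t_{k,n}$ denote the smallest real number $t>0$ such that $P_k(A)\le |A|^t$ holds for every positive integer $d$ and every set $A\subseteq\{0,1,\ldots,n-1\}^d$. For $m\ge 1$ let \[ H_m := -\sum_{j=0}^{m}\frac{\binom{m}{j}}{2^m}\log_2\frac{\binom{m}{j}}{2^m} \] be the Shannon entropy of the symmetric binomial distribution $B(m,1/2)$. Theorem. Let $n\ge 2$ be an integer. The smallest number $t_{k,n}$ exists for every integer $k\ge 2$, and \[ \lim_{k\to\infty}\left( t_{k,n} - \frac{(n-1)\log_2(2k)-\log_2\big((n-1)!\big)}{H_{n-1}}\right) = 0. \] -/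

import Mathlib

open Filter Topology

noncomputable section

/-- The set of `(k + 1)`-tuples `(a, h₁, …, h_k)` of points of `ℤ^d` such that
`a + ε₁ h₁ + ⋯ + ε_k h_k ∈ A` for every `(ε₁, …, ε_k) ∈ {0, 1}^k`. -/
def parallelotopes (k : ℕ) {d : ℕ} (A : Finset (Fin d → ℤ)) :
    Set ((Fin d → ℤ) × (Fin k → Fin d → ℤ)) :=
  {p | ∀ ε : Fin k → Fin 2, p.1 + ∑ i, (ε i : ℕ) • p.2 i ∈ A}

/-- There are only finitely many such tuples, so that counting them by `Set.ncard` is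
meaningful. -/
theorem parallelotopes_finite (k : ℕ) {d : ℕ} (A : Finset (Fin d → ℤ)) :
    (parallelotopes k A).Finite := by
  have hfin : ((A : Set (Fin d → ℤ)) ×ˢ
      (Set.univ.pi fun _ : Fin k => (A : Set (Fin d → ℤ)))).Finite :=
    A.finite_toSet.prod (Set.Finite.pi fun _ => A.finite_toSet)
  refine Set.Finite.of_injOn (f := fun p => (p.1, fun i => p.1 + p.2 i)) ?_ ?_ hfin
  · intro p hp
    refine ⟨by simpa using hp 0, fun i _ => ?_⟩
    have h := hp (Pi.single i 1)
    rw [Finset.sum_eq_single i] at h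
    · simpa using h
    · intro j _ hj
      simp [Pi.single_eq_of_ne hj]
    · simp
  · rintro ⟨a, h⟩ _ ⟨a', h'⟩ _ heq
    simp only [Prod.mk.injEq] at heq
    obtain ⟨rfl, heq⟩ := heq
    refine Prod.ext rfl (funext fun i => ?_)
    simpa using congrFun heq i

/-- The generalized additive energy `P_k(A)` of a finite set `A ⊆ ℤ^d`. -/
def parallelotopeEnergy (k : ℕ) {d : ℕ} (A : Finset (Fin d → ℤ)) : ℕ :=
  (parallelotopes k A).ncard

/-- The numbers `t > 0` such that `P_k(A) ≤ |A|^t` for every positive integer `d` and every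
subset `A` of the discrete cube `{0, 1, …, n - 1}^d`. -/
def admissibleExponents (k n : ℕ) : Set ℝ :=
  {t | 0 < t ∧ ∀ d : ℕ, 0 < d → ∀ A : Finset (Fin d → ℤ),
    (∀ a ∈ A, ∀ i, 0 ≤ a i ∧ a i < (n : ℤ)) →
      (parallelotopeEnergy k A : ℝ) ≤ (A.card : ℝ) ^ t}

/-- The optimal exponent `t_{k,n}`. -/
def optimalExponent (k n : ℕ) : ℝ :=
  sInf (admissibleExponents k n)

/-- The Shannon entropy `H_m`, in bits, of the symmetric binomial distribution `B(m, 1/2)`. -/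
def binomialEntropy (m : ℕ) : ℝ :=
  -∑ j ∈ Finset.range (m + 1),
    ((m.choose j : ℝ) / 2 ^ m) * Real.logb 2 ((m.choose j : ℝ) / 2 ^ m)

end

/-! Put N = n - 1. A parallelotope of dimension k inside {0,…,N} has at most N nonzero directions.
Those with exactly N are given by an N-element set of directions with signs, so there are C(k,N) 2^N
~ (2k)^N / N! of them, and their vertices are distributed as B(N,1/2). The claim is that these
extremal parallelotopes determine the exponent: t H_N is asymptotically log₂(C(k,N) 2^N).

Upper bound. The inequality P_k(A) ≤ |A|^t is strengthened to a bound of the Gowers box form by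
ℓ^{1/s} norms, s = t/2^k, with a separate function at each vertex. This form tensorizes
(`BoxBound.prod`), so dimension one suffices. There the Gowers–Cauchy–Schwarz inequality
(`boxForm_le_prod`) leaves one function, that is, a probability vector p on {0,…,N}, and the sum
over parallelotopes of ∏ p(vertex)^s has to be at most 1. A rearrangement argument with Gibbs'
inequality (`sum_cube_log_le`) bounds a term with m nonzero directions by 2^(-t H_m), and there are
O(k^m) such terms. Since H_m/m is strictly decreasing (`mul_binomialEntropy_lt`), t ≈ (N/H_N) log₂ k
makes the terms with 0 < m < N negligible, and those with m = N contribute at most 2^(-δ H_N) < 1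
once t exceeds the asymptotic value by δ. If p is nearly a point mass, a cruder estimate is used
(`sum_vertexWeight_le_one`).

Lower bound. Sequences of the M = C(k,N) 2^N sign patterns using every pattern equally often give
about M^d parallelotopes in dimension d. Their vertices all lie in a single type class of
B(N,1/2)^d, which has at most 2^(d H_N) points. Letting d grow gives log₂ M ≤ t H_N
(`logb_le_of_mem_admissibleExponents`). -/

/-! ### Binomial entropy: concavity in m and strict decrease of H_m/m. -/

/-- The sum of `x log x` over a row of Pascal's triangle. -/
noncomputable def chooseLogSum (m : ℕ) : ℝ :=
  ∑ j ∈ Finset.range (m + 1), (m.choose j : ℝ) * Real.log (m.choose j)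

/-- The sum of `φ (j / m)` for `φ x = x log x`, weighted by a row of Pascal's triangle. -/
noncomputable def chooseMulLogSum (m : ℕ) : ℝ :=
  ∑ j ∈ Finset.range (m + 1), (m.choose j : ℝ) * ((j / m : ℝ) * Real.log (j / m))

theorem sum_range_choose_real (m : ℕ) :
    ∑ j ∈ Finset.range (m + 1), (m.choose j : ℝ) = 2 ^ m := by
  exact_mod_cast Nat.sum_range_choose m

theorem binomialEntropy_eq (m : ℕ) :
    binomialEntropy m = m - chooseLogSum m / (2 ^ m * Real.log 2) := by
  have hl : Real.log 2 ≠ 0 := (Real.log_pos one_lt_two).ne'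
  have h : ∀ j ∈ Finset.range (m + 1),
      ((m.choose j : ℝ) / 2 ^ m) * Real.logb 2 ((m.choose j : ℝ) / 2 ^ m) =
        (m.choose j * Real.log (m.choose j)) / (2 ^ m * Real.log 2) - m.choose j * (m / 2 ^ m) := by
    intro j hj
    have hc : (m.choose j : ℝ) ≠ 0 := by
      exact_mod_cast (Nat.choose_pos (Nat.lt_succ_iff.1 (Finset.mem_range.1 hj))).ne'
    rw [Real.logb, Real.log_div hc (by positivity), Real.log_pow]
    field_simp
  rw [binomialEntropy, Finset.sum_congr rfl h, Finset.sum_sub_distrib, ← Finset.sum_div,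
    ← Finset.sum_mul, sum_range_choose_real, chooseLogSum]
  field_simp
  ring

theorem chooseLogSum_nonneg (m : ℕ) : 0 ≤ chooseLogSum m :=
  Finset.sum_nonneg fun _ _ => mul_nonneg (Nat.cast_nonneg _) (Real.log_natCast_nonneg _)

theorem binomialEntropy_le (m : ℕ) : binomialEntropy m ≤ m := by
  rw [binomialEntropy_eq]
  have := div_nonneg (chooseLogSum_nonneg m)
    (mul_nonneg (pow_nonneg zero_le_two m) (Real.log_pos one_lt_two).le)
  linarith

theorem sum_choose_mul_log_succ (m : ℕ) :
    ∑ j ∈ Finset.range (m + 1), (m.choose j : ℝ) * Real.log ((j + 1 : ℝ) / (m + 1)) =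
      chooseMulLogSum (m + 1) := by
  rw [chooseMulLogSum, Finset.sum_range_succ' _ (m + 1)]
  simp only [Nat.cast_zero, zero_div, zero_mul, mul_zero, add_zero]
  refine Finset.sum_congr rfl fun j _ => ?_
  have h : ((m + 1 : ℕ) : ℝ) * m.choose j = (m + 1).choose (j + 1) * ((j + 1 : ℕ) : ℝ) := by
    exact_mod_cast Nat.add_one_mul_choose_eq m j
  push_cast at h ⊢
  rw [← mul_assoc]
  congr 1
  field_simp
  linarith

/-- This is the chain rule for entropy in disguise: with S_m the number of heads, H(S_m) + 1 =
H(S_{m+1}) + H(last toss | S_{m+1}), and given S_{m+1} = j the last toss is Bernoulli with parameter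
j/(m+1). Symmetry merges the two halves of its entropy, whence the factor 2. -/
theorem chooseLogSum_succ (m : ℕ) :
    chooseLogSum (m + 1) = 2 * chooseLogSum m - 2 * chooseMulLogSum (m + 1) := by
  have h1 : chooseLogSum (m + 1) = ∑ j ∈ Finset.range (m + 1), (m.choose j : ℝ) *
      (Real.log ((m + 1).choose j) + Real.log ((m + 1).choose (j + 1))) := by
    rw [chooseLogSum, Finset.sum_range_succ']
    simp only [Nat.choose_succ_succ' m, Nat.cast_add, add_mul, mul_add, Finset.sum_add_distrib]
    have : ∑ j ∈ Finset.range (m + 1), (m.choose j : ℝ) * Real.log ((m + 1).choose j) =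
        ∑ j ∈ Finset.range (m + 1), (m.choose (j + 1) : ℝ) *
          Real.log ((m.choose j : ℝ) + m.choose (j + 1)) := by
      rw [Finset.sum_range_succ', Finset.sum_range_succ]
      simp [Nat.choose_succ_succ']
    rw [this]
    simp
    ring
  have h2 : ∀ j ∈ Finset.range (m + 1), (m.choose j : ℝ) *
      (Real.log ((m + 1).choose j) + Real.log ((m + 1).choose (j + 1))) =
      2 * (m.choose j * Real.log (m.choose j)) -
        m.choose (m - j) * Real.log (((m - j : ℕ) + 1 : ℝ) / (m + 1)) -
        m.choose j * Real.log ((j + 1 : ℝ) / (m + 1)) := by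
    intro j hj
    have hj' : j ≤ m := Nat.lt_succ_iff.1 (Finset.mem_range.1 hj)
    have hc : (0 : ℝ) < m.choose j := by exact_mod_cast Nat.choose_pos hj'
    have hc1 : (0 : ℝ) < (m + 1).choose j := by exact_mod_cast Nat.choose_pos (by omega)
    have hc2 : (0 : ℝ) < (m + 1).choose (j + 1) := by exact_mod_cast Nat.choose_pos (by omega)
    rw [Nat.choose_symm hj']
    have e1 : ((m + 1).choose j : ℝ) * (((m - j : ℕ) + 1 : ℝ) / (m + 1)) = m.choose j := by
      have := Nat.choose_mul_succ_eq m j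
      have h' : (m.choose j : ℝ) * (m + 1) = (m + 1).choose j * ((m - j : ℕ) + 1) := by
        rw [show m + 1 - j = m - j + 1 by omega] at this
        exact_mod_cast this
      field_simp
      linarith
    have e2 : ((m + 1).choose (j + 1) : ℝ) * ((j + 1 : ℝ) / (m + 1)) = m.choose j := by
      have h : ((m + 1 : ℕ) : ℝ) * m.choose j = (m + 1).choose (j + 1) * ((j + 1 : ℕ) : ℝ) := by
        exact_mod_cast Nat.add_one_mul_choose_eq m j
      push_cast at h
      field_simp
      linarith
    have l1 := congrArg Real.log e1
    have l2 := congrArg Real.log e2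
    rw [Real.log_mul hc1.ne' (by positivity)] at l1
    rw [Real.log_mul hc2.ne' (by positivity)] at l2
    linear_combination (m.choose j : ℝ) * l1 + (m.choose j : ℝ) * l2
  rw [h1, Finset.sum_congr rfl h2, Finset.sum_sub_distrib, Finset.sum_sub_distrib,
    ← Finset.mul_sum, sum_choose_mul_log_succ]
  have := Finset.sum_range_reflect
    (fun j : ℕ => (m.choose j : ℝ) * Real.log ((j + 1 : ℝ) / (m + 1))) (m + 1)
  simp only [add_tsub_cancel_right] at this
  rw [this, sum_choose_mul_log_succ, chooseLogSum]
  ring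

/-- Jensen's inequality for x log x: the mean of m + 1 tosses is the average of the means obtained
by deleting one toss, so E φ(S_m/m) does not increase with m. Consequently the increments of H_m do
not increase. -/
theorem chooseMulLogSum_succ_le {m : ℕ} (hm : 1 ≤ m) :
    chooseMulLogSum (m + 1) ≤ 2 * chooseMulLogSum m := by
  set φ : ℝ → ℝ := fun x => x * Real.log x with hφ
  have hm0 : (0 : ℝ) < m := by exact_mod_cast hm
  have hstep : ∀ j ∈ Finset.range (m + 2),
      ((m + 1).choose j : ℝ) * φ ((j : ℝ) / ((m + 1 : ℕ) : ℝ)) ≤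
        ((m + 1).choose j * (j / (m + 1))) * φ (((j : ℝ) - 1) / m) +
          ((m + 1).choose j * ((m + 1 - j) / (m + 1))) * φ ((j : ℝ) / m) := by
    intro j hj
    have hj' : (j : ℝ) ≤ m + 1 := by
      exact_mod_cast Nat.lt_succ_iff.1 (Finset.mem_range.1 hj)
    rcases Nat.eq_zero_or_pos j with rfl | hj0
    · simp [hφ]
    have hj1 : (1 : ℝ) ≤ j := by exact_mod_cast hj0
    have hcv := Real.convexOn_mul_log.2
    have hconv := @hcv (((j : ℝ) - 1) / m) (Set.mem_Ici.2 (div_nonneg (by linarith) hm0.le))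
      ((j : ℝ) / m) (Set.mem_Ici.2 (by positivity)) ((j : ℝ) / (m + 1)) ((m + 1 - j : ℝ) / (m + 1))
      (by positivity) (div_nonneg (by linarith) (by positivity)) (by field_simp; ring)
    simp only [smul_eq_mul] at hconv
    -- Among m + 1 tosses with j heads, the deleted toss is a head with probability j/(m+1).
    have e : (j : ℝ) / (m + 1) * (((j : ℝ) - 1) / m) + (m + 1 - j : ℝ) / (m + 1) * ((j : ℝ) / m) =
        (j : ℝ) / ((m + 1 : ℕ) : ℝ) := by
      push_cast
      field_simp
      ring
    rw [e] at hconv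
    have := mul_le_mul_of_nonneg_left hconv (Nat.cast_nonneg (α := ℝ) ((m + 1).choose j))
    simp only [hφ]
    linarith
  have hsum := Finset.sum_le_sum hstep
  rw [Finset.sum_add_distrib] at hsum
  refine hsum.trans (le_of_eq ?_)
  rw [Finset.sum_range_succ', Finset.sum_range_succ _ (m + 1), two_mul]
  have e1 : ∀ j ∈ Finset.range (m + 1), ((m + 1).choose (j + 1) * (((j + 1 : ℕ) : ℝ) / (m + 1))) *
      φ ((((j + 1 : ℕ) : ℝ) - 1) / m) = m.choose j * φ ((j : ℝ) / m) := by
    intro j _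
    have h : ((m + 1 : ℕ) : ℝ) * m.choose j = (m + 1).choose (j + 1) * ((j + 1 : ℕ) : ℝ) := by
      exact_mod_cast Nat.add_one_mul_choose_eq m j
    push_cast at h ⊢
    rw [add_sub_cancel_right]
    congr 1
    field_simp
    linarith
  have e2 : ∀ j ∈ Finset.range (m + 1), ((m + 1).choose j * ((m + 1 - j : ℝ) / (m + 1))) *
      φ ((j : ℝ) / m) = m.choose j * φ ((j : ℝ) / m) := by
    intro j hj
    have hj' : j ≤ m := Nat.lt_succ_iff.1 (Finset.mem_range.1 hj)
    have := Nat.choose_mul_succ_eq m j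
    have h' : (m.choose j : ℝ) * (m + 1) = (m + 1).choose j * (m + 1 - j) := by
      have e : ((m + 1 - j : ℕ) : ℝ) = m + 1 - j := by
        rw [Nat.cast_sub (by omega)]; push_cast; ring
      rw [← e]
      exact_mod_cast this
    congr 1
    field_simp
    linarith
  rw [Finset.sum_congr rfl e1, Finset.sum_congr rfl e2]
  simp [chooseMulLogSum, hφ]

theorem binomialEntropy_succ (m : ℕ) :
    binomialEntropy (m + 1) =
      binomialEntropy m + (1 + chooseMulLogSum (m + 1) / (2 ^ m * Real.log 2)) := by
  have hl : Real.log 2 ≠ 0 := (Real.log_pos one_lt_two).ne'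
  rw [binomialEntropy_eq, binomialEntropy_eq, chooseLogSum_succ]
  push_cast
  field_simp
  ring

theorem binomialEntropy_gap_le {m : ℕ} (hm : 1 ≤ m) :
    chooseMulLogSum (m + 1) / (2 ^ m * Real.log 2) ≤
      chooseMulLogSum m / (2 ^ (m - 1) * Real.log 2) := by
  have hl : 0 < Real.log 2 := Real.log_pos one_lt_two
  obtain ⟨m, rfl⟩ := Nat.exists_eq_add_of_le' hm
  have := chooseMulLogSum_succ_le hm
  rw [add_tsub_cancel_right, pow_succ, div_le_div_iff₀ (by positivity) (by positivity)]
  have h2 : 0 < 2 ^ m * Real.log 2 := by positivity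
  nlinarith

theorem binomialEntropy_pos {m : ℕ} (hm : 1 ≤ m) : 0 < binomialEntropy m := by
  rw [binomialEntropy, neg_pos]
  refine Finset.sum_neg' (fun j hj => ?_) ⟨0, by simp, ?_⟩
  · refine mul_nonpos_of_nonneg_of_nonpos (by positivity)
      (Real.logb_nonpos one_lt_two (by positivity) ?_)
    rw [div_le_one (by positivity), ← sum_range_choose_real]
    exact Finset.single_le_sum (f := fun j => (m.choose j : ℝ)) (fun _ _ => by positivity) hj
  · refine mul_neg_of_pos_of_neg (by simp) (Real.logb_neg one_lt_two (by simp) ?_)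
    simp only [Nat.choose_zero_right, Nat.cast_one, one_div]
    exact inv_lt_one_of_one_lt₀ (one_lt_pow₀ one_lt_two (by omega))

/-- The entropy H_{m+1} is a sum of m + 1 increments, each at least the next increment H_{m+2} -
H_{m+1}. Strictness comes from the start: H_1 = 1 while H_2 - H_1 = 1/2. -/
theorem mul_gap_lt_binomialEntropy (m : ℕ) :
    (m + 1) * (1 + chooseMulLogSum (m + 2) / (2 ^ (m + 1) * Real.log 2)) <
      binomialEntropy (m + 1) := by
  have hl : 0 < Real.log 2 := Real.log_pos one_lt_two
  induction m with
  | zero =>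
    have h1 : binomialEntropy 1 = 1 := by
      rw [binomialEntropy_eq]; simp [chooseLogSum, Finset.sum_range_succ]
    have h2 : chooseMulLogSum 2 = -Real.log 2 := by
      simp [chooseMulLogSum, Finset.sum_range_succ]
    simp only [zero_add, h1, h2]
    field_simp
    norm_num
  | succ m ih =>
    rw [binomialEntropy_succ (m + 1)]
    have := binomialEntropy_gap_le (m := m + 2) (by omega)
    simp only [show m + 2 - 1 = m + 1 by omega] at this
    push_cast
    have hm : (0 : ℝ) ≤ m := m.cast_nonneg
    rw [show m + 1 + 2 = m + 2 + 1 by ring, show m + 1 + 1 = m + 2 by ring]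
    nlinarith

/-- The entropy per coin toss of the number of heads is strictly decreasing. -/
theorem mul_binomialEntropy_lt {m N : ℕ} (hm : 1 ≤ m) (hmN : m < N) :
    m * binomialEntropy N < N * binomialEntropy m := by
  have step : ∀ m : ℕ, 1 ≤ m →
      m * binomialEntropy (m + 1) < (m + 1 : ℕ) * binomialEntropy m := by
    intro m hm
    obtain ⟨m, rfl⟩ := Nat.exists_eq_add_of_le' hm
    have := mul_gap_lt_binomialEntropy m
    rw [binomialEntropy_succ (m + 1)]
    push_cast
    rw [show m + 1 + 1 = m + 2 by ring]
    nlinarith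
  induction N, hmN using Nat.le_induction with
  | base => exact step m hm
  | succ N hN ih =>
    have h := step N (by omega)
    have hN0 : (0 : ℝ) < N := by exact_mod_cast (by omega : 0 < N)
    have hm0 : (0 : ℝ) < m := by exact_mod_cast hm
    have hN1 : (0 : ℝ) < (N + 1 : ℕ) := by positivity
    refine lt_of_mul_lt_mul_left ?_ hN0.le
    have h1 := mul_lt_mul_of_pos_left h hm0
    have h2 := mul_lt_mul_of_pos_left ih hN1
    nlinarith

/-! ### Generalised cubes of integers: rearrangement and the cross-entropy bound. -/

theorem sum_fin_succ_cube {M : Type*} [AddCommMonoid M] (k : ℕ) (f : (Fin (k + 1) → Fin 2) → M) :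
    ∑ ε, f ε = ∑ ε : Fin k → Fin 2, (f (Fin.cons 0 ε) + f (Fin.cons 1 ε)) := by
  rw [← (Fin.consEquiv fun _ : Fin (k + 1) => Fin 2).sum_comp, Fintype.sum_prod_type_right]
  simp [Fin.consEquiv]

/-- The sum of `u` over `m + 1` consecutive integers, weighted by a row of Pascal's triangle. -/
noncomputable def binomSum (u : ℤ → ℝ) (m : ℕ) (y : ℤ) : ℝ :=
  ∑ i ∈ Finset.range (m + 1), (m.choose i : ℝ) * u (y + i)

theorem binomSum_zero (u : ℤ → ℝ) (y : ℤ) : binomSum u 0 y = u y := by simp [binomSum]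

theorem binomSum_succ (u : ℤ → ℝ) (m : ℕ) (y : ℤ) :
    binomSum u (m + 1) y = binomSum u m y + binomSum u m (y + 1) := by
  unfold binomSum
  rw [Finset.sum_range_succ']
  simp only [Nat.choose_succ_succ' m, Nat.cast_add, add_mul, Finset.sum_add_distrib]
  have : ∑ j ∈ Finset.range (m + 1), (m.choose j : ℝ) * u (y + j) =
      ∑ j ∈ Finset.range (m + 1), (m.choose (j + 1) : ℝ) * u (y + (j + 1 : ℕ)) + u y := by
    rw [Finset.sum_range_succ', Finset.sum_range_succ _ m]
    simp
  rw [this]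
  simp [add_comm, add_left_comm]

/-- The number of nonzero directions of a parallelotope. -/
def effectiveDim {k : ℕ} (h : Fin k → ℤ) : ℕ := (Finset.univ.filter fun i => h i ≠ 0).card

theorem effectiveDim_succ {k : ℕ} (h : Fin (k + 1) → ℤ) :
    effectiveDim h = (if h 0 = 0 then 0 else 1) + effectiveDim (Fin.tail h) := by
  unfold effectiveDim
  rw [Finset.card_filter, Finset.card_filter, Fin.sum_univ_succ]
  simp only [ite_not]
  rfl

theorem effectiveDim_le {k : ℕ} (h : Fin k → ℤ) : effectiveDim h ≤ k :=
  (Finset.card_filter_le _ _).trans (by simp)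

theorem exists_add_notMem {V : Finset ℤ} (hV : V.Nonempty) {c : ℤ} (hc : c ≠ 0) :
    ∃ v ∈ V, v + c ∉ V := by
  rcases lt_or_gt_of_ne hc with h | h
  · exact ⟨V.min' hV, V.min'_mem hV, fun h' => by have := V.min'_le _ h'; omega⟩
  · exact ⟨V.max' hV, V.max'_mem hV, fun h' => by have := V.le_max' _ h'; omega⟩

/-- Symmetric chain decomposition in summed form: if `∑ w` over sets is controlled by `∑ u` over
centred intervals, then `∑ w` over generalised cubes is controlled by binomial sums of `u`. -/
theorem sum_cube_le_binomSum {w u : ℤ → ℝ} {Q : Finset ℤ} {M : ℤ}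
    (hW : ∀ V ⊆ Q, ∀ y : ℤ, 2 * y + V.card - 1 = M →
      ∑ v ∈ V, w v ≤ ∑ i ∈ Finset.range V.card, u (y + i)) {k : ℕ} (h : Fin k → ℤ)
    (V : Finset ℤ) (hV : ∀ v ∈ V, ∀ ε : Fin k → Fin 2, v + ∑ i, (ε i : ℕ) • h i ∈ Q) (y : ℤ)
    (hy : 2 * y + V.card - 1 + effectiveDim h = M) :
    ∑ v ∈ V, ∑ ε : Fin k → Fin 2, w (v + ∑ i, (ε i : ℕ) • h i) ≤
      2 ^ (k - effectiveDim h) *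
        ∑ i ∈ Finset.range V.card, binomSum u (effectiveDim h) (y + i) := by
  induction k generalizing V y with
  | zero =>
    have hd : effectiveDim h = 0 := Nat.le_zero.1 (effectiveDim_le h)
    simp only [hd, binomSum_zero, Fintype.sum_unique, Finset.univ_eq_empty, Finset.sum_empty,
      add_zero, Nat.sub_self, pow_zero, one_mul]
    refine hW V (fun v hv => ?_) y (by simpa [hd] using hy)
    simpa using hV v hv default
  | succ k ih =>
    set h' : Fin k → ℤ := Fin.tail h with hh'
    have hd := effectiveDim_succ h
    have hle := effectiveDim_le h'
    rw [← hh'] at hd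
    have h0 : ∀ (v : ℤ) (ε : Fin k → Fin 2),
        v + ∑ i, ((Fin.cons 0 ε : Fin (k + 1) → Fin 2) i : ℕ) • h i =
          v + ∑ i, (ε i : ℕ) • h' i := by
      intro v ε; simp [Fin.sum_univ_succ, hh', Fin.tail]
    have h1 : ∀ (v : ℤ) (ε : Fin k → Fin 2),
        v + ∑ i, ((Fin.cons 1 ε : Fin (k + 1) → Fin 2) i : ℕ) • h i =
          (v + h 0) + ∑ i, (ε i : ℕ) • h' i := by
      intro v ε; simp [Fin.sum_univ_succ, hh', Fin.tail, add_assoc]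
    have hV0 : ∀ v ∈ V, ∀ ε : Fin k → Fin 2, v + ∑ i, (ε i : ℕ) • h' i ∈ Q := fun v hv ε => by
      rw [← h0]; exact hV v hv _
    have hV1 : ∀ v ∈ V, ∀ ε : Fin k → Fin 2, v + h 0 + ∑ i, (ε i : ℕ) • h' i ∈ Q :=
      fun v hv ε => by rw [← h1]; exact hV v hv _
    simp only [sum_fin_succ_cube, h0, h1, Finset.sum_add_distrib]
    by_cases hz : h 0 = 0
    · rw [if_pos hz, zero_add] at hd
      simp only [hz, add_zero]
      rw [hd, Nat.sub_add_comm hle, pow_succ]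
      have := ih h' V hV0 y (by rw [← hd]; exact hy)
      linarith
    · rw [if_neg hz] at hd
      rcases V.eq_empty_or_nonempty with rfl | hne
      · simp
      obtain ⟨v₀, hv₀, hv₁⟩ := exists_add_notMem hne hz
      obtain ⟨l, hl⟩ := Nat.exists_eq_add_of_le' (Finset.card_pos.2 hne)
      rw [hl] at hy ⊢
      -- Moving the single point v₀ + h 0 from the translate to V turns two sets of size l + 1 into
      -- sets of sizes l + 2 and l. Intervals behave in the same way: [y, y+l] and [y+1, y+l+1]
      -- together are [y, y+l+1] and [y+1, y+l], which are concentric.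
      have hsplit : ∀ G : ℤ → ℝ, ∑ v ∈ V, G v + ∑ v ∈ V, G (v + h 0) =
          ∑ v ∈ insert (v₀ + h 0) V, G v +
            ∑ v ∈ (V.erase v₀).map (addRightEmbedding (h 0)), G v := by
        intro G
        rw [Finset.sum_insert hv₁, Finset.sum_map, ← Finset.add_sum_erase V _ hv₀]
        simp only [addRightEmbedding_apply]
        rw [← Finset.add_sum_erase V (fun v => G (v + h 0)) hv₀]
        ring
      have hc1 : (insert (v₀ + h 0) V).card = l + 2 := by
        rw [Finset.card_insert_of_notMem hv₁, hl]
      have hc2 : ((V.erase v₀).map (addRightEmbedding (h 0))).card = l := by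
        rw [Finset.card_map, Finset.card_erase_of_mem hv₀, hl]; rfl
      have i1 := ih h' (insert (v₀ + h 0) V) (by
        intro v hv
        rcases Finset.mem_insert.1 hv with rfl | hv
        · exact hV1 v₀ hv₀
        · exact hV0 v hv) y (by rw [hc1]; push_cast at hy ⊢; rw [hd] at hy; push_cast at hy; omega)
      have i2 := ih h' ((V.erase v₀).map (addRightEmbedding (h 0))) (by
        intro v hv
        obtain ⟨v', hv', rfl⟩ := Finset.mem_map.1 hv
        exact hV1 v' (Finset.mem_of_mem_erase hv')) (y + 1) (by
          rw [hc2]; push_cast at hy ⊢; rw [hd] at hy; push_cast at hy; omega)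
      rw [hc1] at i1
      rw [hc2] at i2
      rw [hsplit fun v => ∑ ε : Fin k → Fin 2, w (v + ∑ i, (ε i : ℕ) • h' i)]
      refine (add_le_add i1 i2).trans (le_of_eq ?_)
      rw [← mul_add, hd, show k + 1 - (1 + effectiveDim h') = k - effectiveDim h' by omega]
      congr 1
      rw [add_comm 1 (effectiveDim h')]
      simp only [binomSum_succ, Finset.sum_add_distrib]
      rw [Finset.sum_range_succ, add_assoc]
      congr 1
      rw [Finset.sum_range_succ _ l, add_comm]
      congr 1
      · exact Finset.sum_congr rfl fun i _ => by congr 1; ring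
      · push_cast; congr 1; ring

theorem exists_antitone_enumeration (w : ℤ → ℝ) (Q : Finset ℤ) :
    ∃ g : ℕ → ℤ, Set.BijOn g (Set.Iio Q.card) Q ∧ AntitoneOn (w ∘ g) (Set.Iio Q.card) := by
  induction hn : Q.card generalizing Q with
  | zero =>
    rw [Finset.card_eq_zero] at hn
    subst hn
    exact ⟨0, by simp, by simp [AntitoneOn]⟩
  | succ n ih =>
    obtain ⟨x, hx, hmin⟩ := Q.exists_min_image w (Finset.card_pos.1 (by omega))
    obtain ⟨g, hg, hanti⟩ := ih (Q.erase x) (by rw [Finset.card_erase_of_mem hx, hn]; rfl)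
    have hlt : ∀ j, j < n → Function.update g n x j = g j := fun j hj =>
      Function.update_of_ne hj.ne _ _
    have hself : Function.update g n x n = x := Function.update_self _ _ _
    have hmem : ∀ j, j < n → g j ∈ Q.erase x := fun j hj => hg.mapsTo hj
    refine ⟨Function.update g n x, ⟨?_, ?_, ?_⟩, ?_⟩
    · intro j hj
      rcases (Nat.lt_succ_iff_lt_or_eq.1 hj) with hj | rfl
      · rw [hlt j hj]; exact Finset.mem_of_mem_erase (hmem j hj)
      · rw [hself]; exact hx
    · intro i hi j hj hij
      rcases (Nat.lt_succ_iff_lt_or_eq.1 hi) with hi | rfl <;>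
        rcases (Nat.lt_succ_iff_lt_or_eq.1 hj) with hj | rfl
      · rw [hlt i hi, hlt j hj] at hij; exact hg.injOn hi hj hij
      · rw [hlt i hi, hself] at hij
        exact absurd hij (Finset.ne_of_mem_erase (hmem i hi))
      · rw [hlt j hj, hself] at hij
        exact absurd hij.symm (Finset.ne_of_mem_erase (hmem j hj))
      · rfl
    · intro q hq
      by_cases hqx : q = x
      · exact ⟨n, Nat.lt_succ_self n, by rw [hself, hqx]⟩
      · obtain ⟨j, hj, rfl⟩ := hg.surjOn (Finset.mem_coe.2 (Finset.mem_erase.2 ⟨hqx, hq⟩))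
        exact ⟨j, Nat.lt_succ_of_lt hj, hlt j hj⟩
    · intro i hi j hj hij
      simp only [Function.comp]
      rcases (Nat.lt_succ_iff_lt_or_eq.1 hj) with hj | rfl
      · have hi' := lt_of_le_of_lt hij hj
        rw [hlt i hi', hlt j hj]
        exact hanti hi' hj hij
      · rw [hself]
        rcases hij.lt_or_eq with hi' | rfl
        · rw [hlt i hi']; exact hmin _ (Finset.mem_of_mem_erase (hmem i hi'))
        · rw [hself]

theorem sum_le_sum_range_card {n : ℕ} {f : ℕ → ℝ} (hf : AntitoneOn f (Set.Iio n))
    (T : Finset ℕ) (hT : ∀ j ∈ T, j < n) : ∑ j ∈ T, f j ≤ ∑ j ∈ Finset.range T.card, f j := by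
  induction T using Finset.induction_on_max with
  | empty => simp
  | insert x s hs ih =>
    have hx : x ∉ s := fun h => lt_irrefl _ (hs x h)
    rw [Finset.sum_insert hx, Finset.card_insert_of_notMem hx, Finset.sum_range_succ, add_comm]
    have hcard : s.card ≤ x := by
      simpa using Finset.card_le_card (fun y hy => Finset.mem_range.2 (hs y hy) : s ⊆ Finset.range x)
    have hxn := hT x (Finset.mem_insert_self _ _)
    exact add_le_add (ih fun j hj => hT j (Finset.mem_insert_of_mem hj))
      (hf (lt_of_le_of_lt hcard hxn) hxn hcard)

/-- The rank of `z` when `0, …, m` are enumerated from the centre outwards. -/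
def centralRank (m z : ℤ) : ℕ := (if m ≤ 2 * z then 2 * z - m else m - 2 * z - 1).toNat

/-- An interval centred at m/2 with l points carries exactly the ranks 0,…,l-1; removing both
endpoints removes the two largest ranks. -/
theorem sum_centralRank (f : ℕ → ℝ) (m : ℤ) : ∀ (l : ℕ) (y : ℤ), 2 * y + l - 1 = m →
    ∑ i ∈ Finset.range l, f (centralRank m (y + i)) = ∑ j ∈ Finset.range l, f j
  | 0, _, _ => by simp
  | 1, y, hy => by
    have : centralRank m y = 0 := by
      unfold centralRank; push_cast at hy; split_ifs <;> omega
    simp [this]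
  | l + 2, y, hy => by
    push_cast at hy
    rw [Finset.sum_range_succ, Finset.sum_range_succ', Finset.sum_range_succ, Finset.sum_range_succ,
      ← sum_centralRank f m l (y + 1) (by omega)]
    have h1 : centralRank m (y + ((0 : ℕ) : ℤ)) = l := by
      unfold centralRank; split_ifs <;> omega
    have h2 : centralRank m (y + ((l + 1 : ℕ) : ℤ)) = l + 1 := by
      unfold centralRank; split_ifs <;> omega
    rw [h1, h2]
    congr 2
    exact Finset.sum_congr rfl fun i _ => by congr 2; push_cast; ring

theorem centralRank_le {m i : ℕ} (hi : i ≤ m) : centralRank m i ≤ m := by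
  unfold centralRank; split_ifs <;> omega

/-- Gibbs' inequality for the binomial distribution. -/
theorem sum_choose_mul_log_le {m : ℕ} {x : ℕ → ℝ} (hx : ∀ i ≤ m, 0 < x i)
    (hsum : ∑ i ∈ Finset.range (m + 1), x i ≤ 1) :
    ∑ i ∈ Finset.range (m + 1), (m.choose i : ℝ) * Real.log (x i) ≤
      -(2 ^ m * binomialEntropy m * Real.log 2) := by
  have hl : Real.log 2 ≠ 0 := (Real.log_pos one_lt_two).ne'
  have e : -(2 ^ m * binomialEntropy m * Real.log 2) =
      chooseLogSum m - 2 ^ m * (m * Real.log 2) := by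
    rw [binomialEntropy_eq]; field_simp; ring
  rw [e, chooseLogSum, ← sum_range_choose_real, Finset.sum_mul, ← Finset.sum_sub_distrib]
  have hstep : ∀ i ∈ Finset.range (m + 1), (m.choose i : ℝ) * Real.log (x i) ≤
      (m.choose i * Real.log (m.choose i) - m.choose i * (m * Real.log 2)) +
        (2 ^ m * x i - m.choose i) := by
    intro i hi
    have hi' : i ≤ m := Nat.lt_succ_iff.1 (Finset.mem_range.1 hi)
    have hc : (0 : ℝ) < m.choose i := by exact_mod_cast Nat.choose_pos hi'
    have hlog := Real.log_le_sub_one_of_pos (x := x i * 2 ^ m / m.choose i)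
      (by have := hx i hi'; positivity)
    rw [Real.log_div (by have := hx i hi'; positivity) hc.ne',
      Real.log_mul (hx i hi').ne' (by positivity), Real.log_pow] at hlog
    have h2 := mul_le_mul_of_nonneg_left hlog hc.le
    have e : (m.choose i : ℝ) * (x i * 2 ^ m / m.choose i - 1) = 2 ^ m * x i - m.choose i := by
      field_simp
    rw [e] at h2
    linarith
  refine (Finset.sum_le_sum hstep).trans ?_
  rw [Finset.sum_add_distrib]
  have : ∑ i ∈ Finset.range (m + 1), (2 ^ m * x i - (m.choose i : ℝ)) ≤ 0 := by
    rw [Finset.sum_sub_distrib, ← Finset.mul_sum, sum_range_choose_real]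
    have : (0 : ℝ) < 2 ^ m := by positivity
    nlinarith
  linarith

/-- Among the generalised cubes with `m` nonzero directions, the cross entropy is at least the
entropy of the binomial distribution `B(m, 1/2)`. -/
theorem sum_cube_log_le {Q : Finset ℤ} {p : ℤ → ℝ} (hp : ∀ x ∈ Q, 0 < p x)
    (hsum : ∑ x ∈ Q, p x ≤ 1) {k : ℕ} (a : ℤ) (h : Fin k → ℤ)
    (ha : ∀ ε : Fin k → Fin 2, a + ∑ i, (ε i : ℕ) • h i ∈ Q) (hd : effectiveDim h < Q.card) :
    ∑ ε : Fin k → Fin 2, Real.log (p (a + ∑ i, (ε i : ℕ) • h i)) ≤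
      -(2 ^ k * binomialEntropy (effectiveDim h) * Real.log 2) := by
  classical
  obtain ⟨g, hg, hanti⟩ := exists_antitone_enumeration (fun x => Real.log (p x)) Q
  set m := effectiveDim h with hm
  -- Here u is the rearrangement of log p with its largest value in the centre, decreasing outwards.
  -- Over a centred interval of length l it sums to the l largest values of log p, which dominates
  -- the sum over any l-element set.
  have hbound := sum_cube_le_binomSum (w := fun x => Real.log (p x))
    (u := fun z => Real.log (p (g (centralRank m z)))) (Q := Q) (M := m) (by
      intro V hVQ y hy
      rw [sum_centralRank (fun j => Real.log (p (g j))) m V.card y hy]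
      set T := (Finset.range Q.card).filter fun j => g j ∈ V
      have hTlt : ∀ j ∈ T, j < Q.card := fun j hj =>
        Finset.mem_range.1 (Finset.mem_filter.1 hj).1
      have hinj : Set.InjOn g T := hg.injOn.mono fun j hj => hTlt j hj
      have himg : T.image g = V := by
        ext v
        simp only [Finset.mem_image]
        constructor
        · rintro ⟨j, hj, rfl⟩
          exact (Finset.mem_filter.1 hj).2
        · intro hv
          obtain ⟨j, hj, rfl⟩ := hg.surjOn (Finset.mem_coe.2 (hVQ hv))
          exact ⟨j, Finset.mem_filter.2 ⟨Finset.mem_range.2 hj, hv⟩, rfl⟩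
      have hcard : V.card = T.card := by rw [← himg, Finset.card_image_of_injOn hinj]
      rw [hcard, ← himg, Finset.sum_image hinj]
      exact sum_le_sum_range_card hanti T hTlt)
    h {a} (fun v hv => by rw [Finset.mem_singleton.1 hv]; exact ha) 0 (by simp [hm])
  simp only [Finset.sum_singleton, Finset.card_singleton, Finset.sum_range_one] at hbound
  refine hbound.trans ?_
  have hmk : m ≤ k := effectiveDim_le h
  have hgibbs := sum_choose_mul_log_le (m := m) (x := fun i => p (g (centralRank m i)))
    (fun i hi => hp _ (hg.mapsTo (lt_of_le_of_lt (centralRank_le hi) hd))) (by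
      have := sum_centralRank (fun j => p (g j)) m (m + 1) 0 (by push_cast; ring)
      simp only [zero_add] at this
      rw [this]
      refine le_trans ?_ hsum
      have himg : (Finset.range Q.card).image g = Q := by
        rw [← Finset.coe_inj, Finset.coe_image, Finset.coe_range]
        exact hg.image_eq
      have hQ : ∑ x ∈ Q, p x = ∑ j ∈ Finset.range Q.card, p (g j) := by
        conv_lhs => rw [← himg]
        exact Finset.sum_image (by rw [Finset.coe_range]; exact hg.injOn)
      rw [hQ]
      exact Finset.sum_le_sum_of_subset_of_nonneg (Finset.range_mono hd)
        fun j hj _ => (hp _ (hg.mapsTo (Finset.mem_range.1 hj))).le)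
  have e : binomSum (fun z => Real.log (p (g (centralRank m z)))) m (0 + ((0 : ℕ) : ℤ)) =
      ∑ i ∈ Finset.range (m + 1), (m.choose i : ℝ) * Real.log (p (g (centralRank m i))) := by
    simp [binomSum]
  rw [e]
  refine (mul_le_mul_of_nonneg_left hgibbs (by positivity)).trans (le_of_eq ?_)
  have h2 : (2 : ℝ) ^ (k - m) * 2 ^ m = 2 ^ k := by rw [← pow_add, Nat.sub_add_cancel hmk]
  rw [← hm, ← h2]
  ring

/-! ### Gowers box forms: Cauchy–Schwarz and tensorization. -/

open scoped ENNReal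



/-- The Gowers box form of a family of functions indexed by the vertices of the discrete cube. -/
noncomputable def boxForm (k : ℕ) {G : Type*} [AddCommGroup G]
    (F : (Fin k → Fin 2) → G → ℝ≥0∞) : ℝ≥0∞ :=
  ∑' q : G × (Fin k → G), ∏ ε, F ε (q.1 + ∑ i, (ε i : ℕ) • q.2 i)

theorem prod_fin_succ_cube {M : Type*} [CommMonoid M] (k : ℕ) (f : (Fin (k + 1) → Fin 2) → M) :
    ∏ ε, f ε = ∏ ε : Fin k → Fin 2, f (Fin.cons 0 ε) * f (Fin.cons 1 ε) := by
  rw [← (Fin.consEquiv fun _ : Fin (k + 1) => Fin 2).prod_comp, Fintype.prod_prod_type_right]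
  simp [Fin.consEquiv]

theorem tsum_prod_rpow_le {α ι : Type*} (s : Finset ι) (f : ι → α → ℝ≥0∞) {p : ι → ℝ}
    (hp : ∑ i ∈ s, p i = 1) (hp0 : ∀ i ∈ s, 0 ≤ p i) :
    ∑' a, ∏ i ∈ s, f i a ^ p i ≤ ∏ i ∈ s, (∑' a, f i a) ^ p i := by
  let _ : MeasurableSpace α := ⊤
  have := ENNReal.lintegral_prod_norm_pow_le (μ := MeasureTheory.Measure.count) s (f := f)
    (fun i _ => (measurable_from_top (f := f i)).aemeasurable) hp hp0
  simpa only [MeasureTheory.lintegral_count] using this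

section
variable {G : Type*} [AddCommGroup G]

theorem boxForm_succ (k : ℕ) (F : (Fin (k + 1) → Fin 2) → G → ℝ≥0∞) :
    boxForm (k + 1) F = ∑' h : G,
      boxForm k fun ε x => F (Fin.cons 0 ε) x * F (Fin.cons 1 ε) (x + h) := by
  unfold boxForm
  let e : G × (G × (Fin k → G)) ≃ G × (Fin (k + 1) → G) :=
    { toFun := fun p => (p.2.1, Fin.cons p.1 p.2.2)
      invFun := fun q => (q.2 0, (q.1, Fin.tail q.2))
      left_inv := fun p => by simp
      right_inv := fun q => by simp }
  rw [← e.tsum_eq, ENNReal.tsum_prod']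
  refine tsum_congr fun h => tsum_congr fun p => ?_
  rw [prod_fin_succ_cube]
  refine Finset.prod_congr rfl fun ε _ => ?_
  simp [e, Fin.sum_univ_succ, add_comm, add_left_comm]

theorem boxForm_succ_ite_le (k : ℕ) (f g : G → ℝ≥0∞) :
    boxForm (k + 1) (fun ε => if ε 0 = 0 then f else g) ≤
      boxForm (k + 1) (fun _ => f) ^ (2⁻¹ : ℝ) * boxForm (k + 1) (fun _ => g) ^ (2⁻¹ : ℝ) := by
  -- For fixed remaining directions h, the base points of the two opposite faces range independently
  -- over G. The form therefore factors as a sum over h of Q f h * Q g h, to which Cauchy–Schwarz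
  -- applies.
  let Q : (G → ℝ≥0∞) → (Fin k → G) → ℝ≥0∞ := fun f h =>
    ∑' a, ∏ ε : Fin k → Fin 2, f (a + ∑ i, (ε i : ℕ) • h i)
  have key : ∀ f g : G → ℝ≥0∞, boxForm (k + 1) (fun ε => if ε 0 = 0 then f else g) =
      ∑' h, Q f h * Q g h := by
    intro f g
    rw [boxForm_succ]
    unfold boxForm
    simp only [Fin.cons_zero, if_true, one_ne_zero, if_false]
    simp_rw [ENNReal.tsum_prod']
    refine (tsum_congr fun _ => ENNReal.tsum_comm).trans
      (ENNReal.tsum_comm.trans (tsum_congr fun h => ?_))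
    rw [ENNReal.tsum_comm, ← ENNReal.tsum_mul_right]
    refine tsum_congr fun a => ?_
    simp_rw [Finset.prod_mul_distrib]
    rw [ENNReal.tsum_mul_left]
    congr 1
    refine Eq.trans ?_ ((Equiv.addLeft a).tsum_eq _)
    refine tsum_congr fun b => Finset.prod_congr rfl fun ε _ => ?_
    simp [add_right_comm]
  have hf := key f f
  have hg := key g g
  simp only [ite_self] at hf hg
  rw [key, hf, hg]
  have := tsum_prod_rpow_le (Finset.univ : Finset (Fin 2))
    (fun i h => if i = 0 then Q f h * Q f h else Q g h * Q g h) (p := fun _ => 2⁻¹)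
    (by norm_num) (by intros; positivity)
  simp only [Fin.prod_univ_two, if_true, one_ne_zero, if_false] at this
  refine le_trans (le_of_eq (tsum_congr fun h => ?_)) this
  have sq : ∀ x : ℝ≥0∞, (x * x) ^ (2⁻¹ : ℝ) = x := fun x => by
    rw [← pow_two, ← ENNReal.rpow_natCast, ← ENNReal.rpow_mul]; norm_num
  rw [sq, sq]

/-- The Gowers--Cauchy--Schwarz inequality. -/
theorem boxForm_le_prod (k : ℕ) (F : (Fin k → Fin 2) → G → ℝ≥0∞) :
    boxForm k F ≤ ∏ ε, boxForm k (fun _ => F ε) ^ ((2 ^ k)⁻¹ : ℝ) := by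
  induction k with
  | zero =>
    rw [Fintype.prod_unique]
    simp only [pow_zero, inv_one, ENNReal.rpow_one]
    refine le_of_eq (congrArg _ (funext fun ε => ?_))
    exact congrArg F (Subsingleton.elim _ _)
  | succ k ih =>
    have hk : (0 : ℝ) ≤ (2 ^ k)⁻¹ := by positivity
    rw [boxForm_succ]
    -- The inductive hypothesis is applied for each value of the first direction; Hölder's
    -- inequality with 2^k equal exponents then moves the sum over that direction inside the
    -- product.
    refine (ENNReal.tsum_le_tsum fun h => ih _).trans ?_
    refine (tsum_prod_rpow_le _ _ (by simp) (fun _ _ => hk)).trans ?_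
    rw [prod_fin_succ_cube]
    refine Finset.prod_le_prod' fun ε _ => ?_
    have h1 := boxForm_succ_ite_le k (F (Fin.cons 0 ε)) (F (Fin.cons 1 ε))
    rw [boxForm_succ] at h1
    simp only [Fin.cons_zero, if_true, one_ne_zero, if_false] at h1
    refine (ENNReal.rpow_le_rpow h1 hk).trans (le_of_eq ?_)
    rw [ENNReal.mul_rpow_of_nonneg _ _ hk, ← ENNReal.rpow_mul, ← ENNReal.rpow_mul,
      pow_succ, mul_inv_rev]

/-- The box form of functions supported in `Q` is bounded by the product of their
`ℓ^{1/s}` norms. -/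
def BoxBound (k : ℕ) (s : ℝ) (Q : Set G) : Prop :=
  ∀ F : (Fin k → Fin 2) → G → ℝ≥0∞, (∀ ε, ∀ x ∉ Q, F ε x = 0) →
    boxForm k F ≤ ∏ ε, (∑' x, F ε x ^ s⁻¹) ^ s

theorem boxBound_of_const {k : ℕ} {s : ℝ} {Q : Set G}
    (h : ∀ f : G → ℝ≥0∞, (∀ x ∉ Q, f x = 0) →
      boxForm k (fun _ => f) ≤ (∑' x, f x ^ s⁻¹) ^ (2 ^ k * s)) :
    BoxBound k s Q := by
  intro F hF
  refine (boxForm_le_prod k F).trans (Finset.prod_le_prod' fun ε _ => ?_)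
  refine (ENNReal.rpow_le_rpow (h _ (hF ε)) (by positivity)).trans (le_of_eq ?_)
  rw [← ENNReal.rpow_mul]
  congr 1
  field_simp

/-- The bound on R is applied to the slices of the functions, and the bound on Q to the slice norms.
The slices at different vertices are different functions, which is why `BoxBound` allows a whole
family. -/
theorem BoxBound.prod {H : Type*} [AddCommGroup H] {k : ℕ} {s : ℝ} (hs : 0 < s) {Q : Set G}
    {R : Set H} (hQ : BoxBound k s Q) (hR : BoxBound k s R) : BoxBound k s (Q ×ˢ R) := by
  intro F hF
  let e : (G × (Fin k → G)) × (H × (Fin k → H)) ≃ (G × H) × (Fin k → G × H) :=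
    { toFun := fun p => ((p.1.1, p.2.1), fun i => (p.1.2 i, p.2.2 i))
      invFun := fun q => ((q.1.1, fun i => (q.2 i).1), (q.1.2, fun i => (q.2 i).2))
      left_inv := fun p => rfl
      right_inv := fun q => rfl }
  have h1 : boxForm k F = ∑' p : G × (Fin k → G),
      boxForm k fun ε y => F ε (p.1 + ∑ i, (ε i : ℕ) • p.2 i, y) := by
    unfold boxForm
    rw [← e.tsum_eq, ENNReal.tsum_prod']
    refine tsum_congr fun p => tsum_congr fun q => Finset.prod_congr rfl fun ε _ => ?_
    congr 1
    ext <;> simp [e, Prod.fst_sum, Prod.snd_sum]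
  rw [h1]
  refine (ENNReal.tsum_le_tsum fun p => hR _ fun ε y hy => hF ε _ fun h => hy h.2).trans ?_
  refine (hQ (fun ε x => (∑' y, F ε (x, y) ^ s⁻¹) ^ s) fun ε x hx => ?_).trans (le_of_eq ?_)
  · have : ∀ y, F ε (x, y) = 0 := fun y => hF ε _ fun h => hx h.1
    simp [this, hs]
  · refine Finset.prod_congr rfl fun ε _ => ?_
    simp only [ENNReal.rpow_rpow_inv hs.ne', ENNReal.tsum_prod']

theorem BoxBound.congr {H : Type*} [AddCommGroup H] {k : ℕ} {s : ℝ} {Q : Set G} {R : Set H}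
    (e : G ≃+ H) (hQR : ∀ x, x ∈ Q → e x ∈ R) (hQ : BoxBound k s R) : BoxBound k s Q := by
  intro F hF
  have h := hQ (fun ε x => F ε (e.symm x)) fun ε x hx => hF ε _ fun h => hx (by
    simpa using hQR _ h)
  have e1 : boxForm k (fun ε x => F ε (e.symm x)) = boxForm k F := by
    unfold boxForm
    rw [← (e.symm.toEquiv.prodCongr (Equiv.piCongrRight fun _ : Fin k => e.symm.toEquiv)).tsum_eq]
    refine tsum_congr fun q => Finset.prod_congr rfl fun ε _ => ?_
    simp
  rw [e1] at h
  refine h.trans (le_of_eq (Finset.prod_congr rfl fun ε _ => ?_))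
  rw [← e.symm.toEquiv.tsum_eq]
  rfl

end

theorem boxBound_cube {k : ℕ} {s : ℝ} (hs : 0 < s) {Q : Set ℤ} (hQ : BoxBound k s Q) (d : ℕ) :
    BoxBound k s {x : Fin d → ℤ | ∀ i, x i ∈ Q} := by
  induction d with
  | zero =>
    intro F _
    unfold boxForm
    rw [tsum_eq_single (0 : (Fin 0 → ℤ) × (Fin k → Fin 0 → ℤ))
      fun b hb => (hb (Subsingleton.elim _ _)).elim]
    refine le_of_eq (Finset.prod_congr rfl fun ε _ => ?_)
    rw [tsum_eq_single (0 : Fin 0 → ℤ) fun b hb => (hb (Subsingleton.elim _ _)).elim,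
      ENNReal.rpow_inv_rpow hs.ne']
    congr 1
    exact Subsingleton.elim _ _
  | succ d ih =>
    let e : (Fin (d + 1) → ℤ) ≃+ ℤ × (Fin d → ℤ) :=
      { (Fin.consEquiv fun _ : Fin (d + 1) => ℤ).symm with map_add' := fun x y => rfl }
    exact BoxBound.congr e (R := Q ×ˢ {x : Fin d → ℤ | ∀ i, x i ∈ Q})
      (fun x (hx : ∀ i, x i ∈ Q) => ⟨hx 0, fun i => hx i.succ⟩) (hQ.prod hs ih)

theorem boxForm_indicator (k : ℕ) {d : ℕ} (A : Finset (Fin d → ℤ)) :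
    boxForm k (fun _ => (A : Set (Fin d → ℤ)).indicator 1) = parallelotopeEnergy k A := by
  classical
  unfold boxForm
  rw [parallelotopeEnergy, Set.ncard_eq_toFinset_card _ (parallelotopes_finite k A),
    tsum_eq_sum (s := (parallelotopes_finite k A).toFinset)]
  · rw [Finset.sum_congr rfl (g := fun _ => 1)]
    · simp
    · intro q hq
      rw [Set.Finite.mem_toFinset] at hq
      exact Finset.prod_eq_one fun ε _ => Set.indicator_of_mem (hq ε) _
  · intro q hq
    rw [Set.Finite.mem_toFinset] at hq
    simp only [parallelotopes, Set.mem_ofPred_eq, not_forall] at hq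
    obtain ⟨ε, hε⟩ := hq
    exact Finset.prod_eq_zero (Finset.mem_univ ε) (Set.indicator_of_notMem (by exact hε) _)

theorem parallelotopeEnergy_le_of_boxBound {k : ℕ} {t : ℝ} (ht : 0 < t) {Q : Set ℤ}
    (hQ : BoxBound k (t / 2 ^ k) Q) {d : ℕ} (A : Finset (Fin d → ℤ)) (hA : ∀ a ∈ A, ∀ i, a i ∈ Q) :
    (parallelotopeEnergy k A : ℝ) ≤ (A.card : ℝ) ^ t := by
  have hs : 0 < t / 2 ^ k := by positivity
  have h := boxBound_cube hs hQ d (fun _ => (A : Set (Fin d → ℤ)).indicator 1)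
    fun ε x hx => Set.indicator_of_notMem (fun h => hx fun i => hA x h i) _
  have hsum : ∑' x, (A : Set (Fin d → ℤ)).indicator (1 : (Fin d → ℤ) → ℝ≥0∞) x ^ (t / 2 ^ k)⁻¹ =
      A.card := by
    rw [tsum_eq_sum (s := A)]
    · rw [Finset.sum_congr rfl (g := fun _ => 1)]
      · simp
      · intro x hx
        rw [Set.indicator_of_mem (by exact hx)]
        simp
    · intro x hx
      rw [Set.indicator_of_notMem (by exact hx)]
      exact ENNReal.zero_rpow_of_pos (by positivity)
  rw [boxForm_indicator, hsum, Finset.prod_const, ← ENNReal.rpow_natCast, ← ENNReal.rpow_mul] at h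
  have e : t / 2 ^ k * ((Finset.univ : Finset (Fin k → Fin 2)).card : ℕ) = t := by
    simp
  rw [e] at h
  have h' := ENNReal.toReal_mono (ENNReal.rpow_ne_top_of_nonneg ht.le (by simp)) h
  simpa [← ENNReal.toReal_rpow] using h'

/-! ### Counting parallelotopes on a line by number of nonzero directions. -/

/-- The `(k + 1)`-tuples of integers spanning a parallelotope in `{0, …, N}`. -/
noncomputable def lineParallelotopes (k N : ℕ) : Finset (ℤ × (Fin k → ℤ)) :=
  (Finset.Icc 0 (N : ℤ) ×ˢ Fintype.piFinset fun _ => Finset.Icc (-N : ℤ) N).filter fun q =>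
    ∀ ε : Fin k → Fin 2, q.1 + ∑ i, (ε i : ℕ) • q.2 i ∈ Finset.Icc 0 (N : ℤ)

theorem mem_lineParallelotopes {k N : ℕ} {q : ℤ × (Fin k → ℤ)} :
    q ∈ lineParallelotopes k N ↔
      ∀ ε : Fin k → Fin 2, q.1 + ∑ i, (ε i : ℕ) • q.2 i ∈ Finset.Icc 0 (N : ℤ) := by
  refine ⟨fun h => (Finset.mem_filter.1 h).2, fun h => Finset.mem_filter.2 ⟨?_, h⟩⟩
  have h0 : q.1 ∈ Finset.Icc 0 (N : ℤ) := by simpa using h 0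
  refine Finset.mem_product.2 ⟨h0, Fintype.mem_piFinset.2 fun i => ?_⟩
  have h1 := h (Pi.single i 1)
  rw [Finset.sum_eq_single i (fun j _ hj => by simp [Pi.single_eq_of_ne hj]) (by simp)] at h1
  simp only [Pi.single_eq_same, Fin.val_one, one_smul, Finset.mem_Icc] at h0 h1 ⊢
  omega

theorem lineParallelotopes_bounds {k N : ℕ} {q : ℤ × (Fin k → ℤ)}
    (hq : q ∈ lineParallelotopes k N) :
    ∑ i, max (-q.2 i) 0 ≤ q.1 ∧ q.1 + ∑ i, max (q.2 i) 0 ≤ N := by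
  rw [mem_lineParallelotopes] at hq
  -- The largest and the smallest vertex.
  have h1 := hq fun i => if 0 ≤ q.2 i then 1 else 0
  have h2 := hq fun i => if 0 ≤ q.2 i then 0 else 1
  have e1 : ∑ i, (((if 0 ≤ q.2 i then 1 else 0 : Fin 2) : ℕ) • q.2 i) = ∑ i, max (q.2 i) 0 :=
    Finset.sum_congr rfl fun i _ => by
      split_ifs with h
      · simp [max_eq_left h]
      · simp [max_eq_right (not_le.1 h).le]
  have e2 : ∑ i, (((if 0 ≤ q.2 i then 0 else 1 : Fin 2) : ℕ) • q.2 i) =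
      -∑ i, max (-q.2 i) 0 := by
    rw [← Finset.sum_neg_distrib]
    refine Finset.sum_congr rfl fun i _ => ?_
    split_ifs with h
    · rw [max_eq_right (by omega)]; simp
    · rw [max_eq_left (by omega)]; simp
  rw [e1] at h1
  rw [e2] at h2
  exact ⟨by have := (Finset.mem_Icc.1 h2).1; omega, (Finset.mem_Icc.1 h1).2⟩

theorem max_neg_add_max (x : ℤ) : (if x = 0 then (0 : ℤ) else 1) ≤ max (-x) 0 + max x 0 := by
  split_ifs <;> omega

theorem effectiveDim_eq_sum {k : ℕ} (h : Fin k → ℤ) :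
    (effectiveDim h : ℤ) = ∑ i, if h i = 0 then (0 : ℤ) else 1 := by
  unfold effectiveDim
  rw [Finset.card_filter]
  push_cast
  exact Finset.sum_congr rfl fun i _ => by split_ifs <;> simp_all

theorem effectiveDim_le_of_mem {k N : ℕ} {q : ℤ × (Fin k → ℤ)}
    (hq : q ∈ lineParallelotopes k N) : effectiveDim q.2 ≤ N := by
  obtain ⟨h1, h2⟩ := lineParallelotopes_bounds hq
  have := Finset.sum_le_sum fun i (_ : i ∈ Finset.univ) => max_neg_add_max (q.2 i)
  rw [← effectiveDim_eq_sum, Finset.sum_add_distrib] at this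
  omega

/-- The sum of the |h_i| is at most N, so N nonzero directions must all be ±1 and the parallelotope
fills {0,…,N}. This rigidity gives the exact leading constant 2^N C(k,N). -/
theorem eq_of_effectiveDim_eq {k N : ℕ} {q : ℤ × (Fin k → ℤ)}
    (hq : q ∈ lineParallelotopes k N) (hd : effectiveDim q.2 = N) :
    q.1 = ∑ i, max (-q.2 i) 0 ∧ ∀ i, q.2 i = -1 ∨ q.2 i = 0 ∨ q.2 i = 1 := by
  obtain ⟨h1, h2⟩ := lineParallelotopes_bounds hq
  have hle := fun i (_ : i ∈ Finset.univ) => max_neg_add_max (q.2 i)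
  have hsum := Finset.sum_le_sum hle
  rw [← effectiveDim_eq_sum, Finset.sum_add_distrib, hd] at hsum
  have heq : ∑ i, (if q.2 i = 0 then (0 : ℤ) else 1) =
      ∑ i, (max (-q.2 i) 0 + max (q.2 i) 0) := by
    rw [← effectiveDim_eq_sum, Finset.sum_add_distrib, hd]; omega
  refine ⟨by omega, fun i => ?_⟩
  have := (Finset.sum_eq_sum_iff_of_le hle).1 heq i (Finset.mem_univ i)
  split_ifs at this <;> omega

/-- Pairs of an `N`-element set of directions and a subset of it. -/
def signPatterns (k N : ℕ) : Finset (Σ _ : Finset (Fin k), Finset (Fin k)) :=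
  (Finset.powersetCard N Finset.univ).sigma fun I => I.powerset

theorem card_signPatterns (k N : ℕ) : (signPatterns k N).card = k.choose N * 2 ^ N := by
  rw [signPatterns, Finset.card_sigma, Finset.sum_congr rfl (g := fun _ => 2 ^ N)]
  · simp
  · intro I hI
    rw [Finset.card_powerset, (Finset.mem_powersetCard.1 hI).2]

theorem card_effectiveDim_eq_top_le (k N : ℕ) :
    ((lineParallelotopes k N).filter fun q => effectiveDim q.2 = N).card ≤ k.choose N * 2 ^ N := by
  rw [← card_signPatterns]
  refine Finset.card_le_card_of_injOn (fun q => ⟨Finset.univ.filter fun i => q.2 i ≠ 0,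
    Finset.univ.filter fun i => q.2 i = -1⟩) ?_ ?_
  · intro q hq
    obtain ⟨-, hd⟩ := Finset.mem_filter.1 hq
    refine Finset.mem_sigma.2 ⟨Finset.mem_powersetCard.2 ⟨Finset.subset_univ _, hd⟩,
      Finset.mem_powerset.2 fun i hi => ?_⟩
    simp only [Finset.mem_filter, Finset.mem_univ, true_and] at hi ⊢
    omega
  · intro q hq r hr hqr
    obtain ⟨hq, hdq⟩ := Finset.mem_filter.1 hq
    obtain ⟨hr, hdr⟩ := Finset.mem_filter.1 hr
    obtain ⟨hq1, hq2⟩ := eq_of_effectiveDim_eq hq hdq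
    obtain ⟨hr1, hr2⟩ := eq_of_effectiveDim_eq hr hdr
    simp only [Sigma.mk.injEq, heq_eq_eq] at hqr
    have h2 : q.2 = r.2 := by
      funext i
      have h3 := Finset.ext_iff.1 hqr.1 i
      have h4 := Finset.ext_iff.1 hqr.2 i
      simp only [Finset.mem_filter, Finset.mem_univ, true_and] at h3 h4
      have := hq2 i
      have := hr2 i
      omega
    exact Prod.ext (by rw [hq1, hr1, h2]) h2

theorem card_effectiveDim_eq_le (k N m : ℕ) :
    ((lineParallelotopes k N).filter fun q => effectiveDim q.2 = m).card ≤
      (N + 1) * ((2 * N + 1) * k) ^ m := by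
  classical
  let s : Finset (ℤ × (Fin m → Fin k) × (Fin m → ℤ)) :=
    Finset.Icc 0 (N : ℤ) ×ˢ Finset.univ ×ˢ Fintype.piFinset fun _ => Finset.Icc (-N : ℤ) N
  have hs : s.card = (N + 1) * ((2 * N + 1) * k) ^ m := by
    simp only [s, Finset.card_product, Int.card_Icc, Finset.card_univ, Fintype.card_fun,
      Fintype.card_fin, Fintype.card_piFinset, Finset.prod_const]
    rw [show ((N : ℤ) + 1 - 0).toNat = N + 1 by omega,
      show ((N : ℤ) + 1 - -N).toNat = 2 * N + 1 by omega, mul_comm (k ^ m), ← mul_pow]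
  rw [← hs]
  -- A crude count suffices here: base point, m positions and m values.
  refine Finset.card_le_card_of_surjOn
    (fun p => (p.1, ∑ j, Pi.single (p.2.1 j) (p.2.2 j))) ?_
  intro q hq
  obtain ⟨hq, hd⟩ := Finset.mem_filter.1 hq
  obtain ⟨hq0, -⟩ := Finset.mem_filter.1 hq
  obtain ⟨ha, hh⟩ := Finset.mem_product.1 hq0
  let e := Finset.equivFinOfCardEq hd
  refine ⟨(q.1, fun j => (e.symm j).1, fun j => q.2 (e.symm j).1), ?_, ?_⟩
  · refine Finset.mem_coe.2 (Finset.mem_product.2 ⟨ha, Finset.mem_product.2 ⟨Finset.mem_univ _,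
      Fintype.mem_piFinset.2 fun j => Fintype.mem_piFinset.1 hh _⟩⟩)
  · refine Prod.ext rfl ?_
    simp only
    rw [e.symm.sum_comp fun i => (Pi.single i.1 (q.2 i.1) : Fin k → ℤ),
      Finset.sum_coe_sort (Finset.univ.filter fun i => q.2 i ≠ 0)
        fun i => (Pi.single i (q.2 i) : Fin k → ℤ)]
    rw [Finset.sum_filter_of_ne, Finset.univ_sum_single]
    intro i _ hi h0
    exact hi (by rw [h0, Pi.single_zero])

/-! ### The weighted inequality in dimension one. -/

/-- The weight of a one-dimensional parallelotope. -/
noncomputable def vertexWeight {k : ℕ} (p : ℤ → ℝ) (s : ℝ) (q : ℤ × (Fin k → ℤ)) : ℝ :=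
  ∏ ε : Fin k → Fin 2, p (q.1 + ∑ i, (ε i : ℕ) • q.2 i) ^ s

section
variable {k N : ℕ} {p : ℤ → ℝ} {t : ℝ}

theorem vertexWeight_le_entropy (hp : ∀ x ∈ Finset.Icc 0 (N : ℤ), 0 < p x)
    (hsum : ∑ x ∈ Finset.Icc 0 (N : ℤ), p x ≤ 1) (ht : 0 ≤ t) {q : ℤ × (Fin k → ℤ)}
    (hq : q ∈ lineParallelotopes k N) :
    vertexWeight p (t / 2 ^ k) q ≤ (2 : ℝ) ^ (-(t * binomialEntropy (effectiveDim q.2))) := by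
  have hq' := mem_lineParallelotopes.1 hq
  have h := sum_cube_log_le hp hsum q.1 q.2 hq' (by
    have := effectiveDim_le_of_mem hq
    rw [Int.card_Icc]; omega)
  have e : vertexWeight p (t / 2 ^ k) q = Real.exp (t / 2 ^ k *
      ∑ ε : Fin k → Fin 2, Real.log (p (q.1 + ∑ i, (ε i : ℕ) • q.2 i))) := by
    rw [Finset.mul_sum, Real.exp_sum]
    refine Finset.prod_congr rfl fun ε _ => ?_
    rw [Real.rpow_def_of_pos (hp _ (hq' ε)), mul_comm]
  rw [e, Real.rpow_def_of_pos two_pos]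
  refine Real.exp_le_exp.2 ((mul_le_mul_of_nonneg_left h (by positivity)).trans (le_of_eq ?_))
  field_simp

/-- Pair the vertices along a nonzero direction. The ends of an edge differ, so at least one of them
is not x₀ and has mass at most η; only half of the exponent t is thus retained. The entropy bound
would not do near a point mass, since it does not tend to 0 with η. -/
theorem vertexWeight_le_of_ne_zero (hp : ∀ x ∈ Finset.Icc 0 (N : ℤ), 0 ≤ p x)
    (hp1 : ∀ x ∈ Finset.Icc 0 (N : ℤ), p x ≤ 1) {η : ℝ} {x₀ : ℤ} (hη0 : 0 ≤ η)
    (hη : ∀ x ∈ Finset.Icc 0 (N : ℤ), x ≠ x₀ → p x ≤ η) (ht : 0 ≤ t) {q : ℤ × (Fin k → ℤ)}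
    (hq : q ∈ lineParallelotopes k N) (h0 : effectiveDim q.2 ≠ 0) :
    vertexWeight p (t / 2 ^ k) q ≤ η ^ (t / 2) := by
  have hq' := mem_lineParallelotopes.1 hq
  have hs : 0 ≤ t / 2 ^ k := by positivity
  obtain ⟨i, hi⟩ := Finset.card_pos.1 (Nat.pos_of_ne_zero h0)
  have hi : q.2 i ≠ 0 := (Finset.mem_filter.1 hi).2
  let X : (Fin k → Fin 2) → ℤ := fun ε => q.1 + ∑ i, (ε i : ℕ) • q.2 i
  let flip : Equiv.Perm (Fin k → Fin 2) := Equiv.addRight (Pi.single i 1)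
  have hX : ∀ ε, X (flip ε) ≠ X ε := by
    intro ε hε
    have h1 : ∑ j, ((flip ε j : ℕ) • q.2 j) = ∑ j, ((ε j : ℕ) • q.2 j) := by
      simpa [X] using hε
    rw [← Finset.add_sum_erase _ _ (Finset.mem_univ i),
      ← Finset.add_sum_erase _ (fun j => (ε j : ℕ) • q.2 j) (Finset.mem_univ i)] at h1
    have h2 : ∑ j ∈ Finset.univ.erase i, ((flip ε j : ℕ) • q.2 j) =
        ∑ j ∈ Finset.univ.erase i, ((ε j : ℕ) • q.2 j) :=
      Finset.sum_congr rfl fun j hj => by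
        simp [flip, Pi.single_eq_of_ne (Finset.ne_of_mem_erase hj)]
    rw [h2, add_left_inj] at h1
    have h3 : flip ε i = ε i + 1 := by simp [flip]
    rw [h3] at h1
    generalize ε i = b at h1
    fin_cases b
    · simp at h1; exact hi h1
    · simp at h1; exact hi h1.symm
  have hsq : vertexWeight p (t / 2 ^ k) q * vertexWeight p (t / 2 ^ k) q ≤ η ^ t := by
    have e1 : vertexWeight p (t / 2 ^ k) q = ∏ ε, p (X (flip ε)) ^ (t / 2 ^ k) :=
      (Equiv.prod_comp flip fun ε => p (X ε) ^ (t / 2 ^ k)).symm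
    have e2 : η ^ t = ∏ _ε : Fin k → Fin 2, η ^ (t / 2 ^ k) := by
      rw [Finset.prod_const, ← Real.rpow_natCast, ← Real.rpow_mul hη0]
      congr 1
      simp
    conv_lhs => arg 1; rw [e1]
    rw [vertexWeight, ← Finset.prod_mul_distrib, e2]
    refine Finset.prod_le_prod (fun ε _ => mul_nonneg (Real.rpow_nonneg (hp _ (hq' _)) _)
      (Real.rpow_nonneg (hp _ (hq' _)) _)) fun ε _ => ?_
    change p (X (flip ε)) ^ (t / 2 ^ k) * p (X ε) ^ (t / 2 ^ k) ≤ _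
    rw [← Real.mul_rpow (hp _ (hq' _)) (hp _ (hq' _))]
    refine Real.rpow_le_rpow (mul_nonneg (hp _ (hq' _)) (hp _ (hq' _))) ?_ hs
    by_cases hx : X ε = x₀
    · have := hη _ (hq' (flip ε)) fun h => hX ε (h.trans hx.symm)
      have h1 := hp1 _ (hq' ε)
      have h2 := hp _ (hq' (flip ε))
      exact (mul_le_of_le_one_right h2 h1).trans this
    · have := hη _ (hq' ε) hx
      have h1 := hp1 _ (hq' (flip ε))
      have h2 := hp _ (hq' ε)
      exact (mul_le_of_le_one_left h2 h1).trans this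
  have e3 : η ^ t = η ^ (t / 2) * η ^ (t / 2) := by
    rw [← Real.rpow_add_of_nonneg hη0 (by positivity) (by positivity)]; congr 1; ring
  rw [e3] at hsq
  exact abs_le_of_sq_le_sq' (by simpa only [sq] using hsq) (Real.rpow_nonneg hη0 _) |>.2

theorem effectiveDim_eq_zero_iff {h : Fin k → ℤ} : effectiveDim h = 0 ↔ h = 0 := by
  simp [effectiveDim, Finset.card_eq_zero, Finset.filter_eq_empty_iff, funext_iff]

theorem sum_vertexWeight_zero (hp : ∀ x ∈ Finset.Icc 0 (N : ℤ), 0 ≤ p x) :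
    ∑ q ∈ (lineParallelotopes k N).filter (fun q => effectiveDim q.2 = 0),
      vertexWeight p (t / 2 ^ k) q = ∑ x ∈ Finset.Icc 0 (N : ℤ), p x ^ t := by
  symm
  refine Finset.sum_bij (fun x _ => (x, 0)) ?_ ?_ ?_ ?_
  · intro x hx
    refine Finset.mem_filter.2 ⟨mem_lineParallelotopes.2 fun ε => ?_,
      effectiveDim_eq_zero_iff.2 rfl⟩
    simpa using hx
  · intro x _ y _ h
    exact congrArg Prod.fst h
  · intro q hq
    obtain ⟨hq, hd⟩ := Finset.mem_filter.1 hq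
    refine ⟨q.1, by simpa using mem_lineParallelotopes.1 hq 0, ?_⟩
    exact Prod.ext rfl (effectiveDim_eq_zero_iff.1 hd).symm
  · intro x hx
    simp only [vertexWeight, Pi.zero_apply, smul_zero, Finset.sum_const_zero, add_zero,
      Finset.prod_const]
    rw [← Real.rpow_natCast, ← Real.rpow_mul (hp x hx)]
    congr 1
    simp

theorem sum_rpow_le {Q : Finset ℤ} (hp : ∀ x ∈ Q, 0 ≤ p x) (hsum : ∑ x ∈ Q, p x ≤ 1) {μ : ℝ}
    (hμ0 : 0 ≤ μ) (hμ : ∀ x ∈ Q, p x ≤ μ) (ht : 1 ≤ t) : ∑ x ∈ Q, p x ^ t ≤ μ ^ (t - 1) := by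
  have : ∀ x ∈ Q, p x ^ t ≤ p x * μ ^ (t - 1) := fun x hx => by
    calc p x ^ t = p x ^ (1 + (t - 1)) := by congr 1; ring
      _ = p x * p x ^ (t - 1) := by
        rw [Real.rpow_add_of_nonneg (hp x hx) zero_le_one (by linarith), Real.rpow_one]
      _ ≤ _ := mul_le_mul_of_nonneg_left
        (Real.rpow_le_rpow (hp x hx) (hμ x hx) (by linarith)) (hp x hx)
  refine (Finset.sum_le_sum this).trans ?_
  rw [← Finset.sum_mul]
  exact mul_le_of_le_one_left (Real.rpow_nonneg hμ0 _) hsum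

theorem sum_vertexWeight_eq (s : ℝ) :
    ∑ q ∈ lineParallelotopes k N, vertexWeight p s q =
      ∑ m ∈ Finset.range N, ∑ q ∈ (lineParallelotopes k N).filter
        (fun q => effectiveDim q.2 = m + 1), vertexWeight p s q +
      ∑ q ∈ (lineParallelotopes k N).filter (fun q => effectiveDim q.2 = 0),
        vertexWeight p s q := by
  rw [← Finset.sum_range_succ' (fun m => ∑ q ∈ (lineParallelotopes k N).filter
    (fun q => effectiveDim q.2 = m), vertexWeight p s q)]
  exact (Finset.sum_fiberwise_of_maps_to (fun q hq =>
    Finset.mem_range.2 (Nat.lt_succ_of_le (effectiveDim_le_of_mem hq))) _).symm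

/-- If some point has mass 1 - η with η < η₀, the degenerate terms sum to at most 1 - η and `hconc`
bounds all others by η. If every mass is at most 1 - η₀, the entropy bound applies and `hspread`
collects the result. -/
theorem sum_vertexWeight_le_one (hp : ∀ x ∈ Finset.Icc 0 (N : ℤ), 0 < p x)
    (hsum : ∑ x ∈ Finset.Icc 0 (N : ℤ), p x = 1) (ht : 2 ≤ t) (hk : 1 ≤ k) {η₀ : ℝ}
    (hη₀ : 0 < η₀) (hη₁ : η₀ ≤ 1 / 2)
    (hconc : N * ((N + 1) * ((2 * N + 1) * k) ^ N) * η₀ ^ (t / 2 - 1) ≤ (1 : ℝ))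
    (hspread : ∑ m ∈ Finset.range (N - 1), ((N + 1) * ((2 * N + 1) * k) ^ (m + 1)) *
      (2 : ℝ) ^ (-(t * binomialEntropy (m + 1))) +
      k.choose N * 2 ^ N * (2 : ℝ) ^ (-(t * binomialEntropy N)) + (1 - η₀) ^ (t - 1) ≤ 1) :
    ∑ q ∈ lineParallelotopes k N, vertexWeight p (t / 2 ^ k) q ≤ 1 := by
  have hp0 : ∀ x ∈ Finset.Icc 0 (N : ℤ), 0 ≤ p x := fun x hx => (hp x hx).le
  have hk' : (1 : ℝ) ≤ k := by exact_mod_cast hk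
  rw [sum_vertexWeight_eq, sum_vertexWeight_zero hp0]
  by_cases hmax : ∃ x₀ ∈ Finset.Icc 0 (N : ℤ), 1 - η₀ < p x₀
  · obtain ⟨x₀, hx₀, hlt⟩ := hmax
    set η := 1 - p x₀ with hη
    have hle : ∀ x ∈ Finset.Icc 0 (N : ℤ), p x ≤ 1 := fun x hx =>
      hsum ▸ Finset.single_le_sum hp0 hx
    have hη0 : 0 ≤ η := by have := hle x₀ hx₀; linarith
    have hother : ∀ x ∈ Finset.Icc 0 (N : ℤ), x ≠ x₀ → p x ≤ η := by
      intro x hx hne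
      have := Finset.add_sum_erase _ p hx₀
      rw [hsum] at this
      have h2 := Finset.single_le_sum (fun y hy => hp0 y (Finset.mem_of_mem_erase hy))
        (Finset.mem_erase.2 ⟨hne, hx⟩)
      linarith
    have h0 : ∑ x ∈ Finset.Icc 0 (N : ℤ), p x ^ t ≤ 1 - η := by
      refine (sum_rpow_le hp0 hsum.le (μ := 1 - η) (by linarith) (fun x hx => ?_)
        (by linarith)).trans ?_
      · by_cases hxx : x = x₀
        · rw [hxx]; linarith
        · have := hother x hx hxx; linarith
      · calc (1 - η) ^ (t - 1) ≤ (1 - η) ^ (1 : ℝ) :=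
              Real.rpow_le_rpow_of_exponent_ge (by linarith) (by linarith) (by linarith)
          _ = 1 - η := Real.rpow_one _
    -- One factor η is kept, to be paid for by the deficit in 1 - η; the rest must beat the number
    -- of terms.
    have hpow : η ^ (t / 2) ≤ η * η₀ ^ (t / 2 - 1) := by
      calc η ^ (t / 2) = η ^ (1 + (t / 2 - 1)) := by congr 1; ring
        _ = η * η ^ (t / 2 - 1) := by
          rw [Real.rpow_add_of_nonneg hη0 zero_le_one (by linarith), Real.rpow_one]
        _ ≤ _ := mul_le_mul_of_nonneg_left
          (Real.rpow_le_rpow hη0 (by linarith) (by linarith)) hη0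
    have h1 : ∀ m ∈ Finset.range N, ∑ q ∈ (lineParallelotopes k N).filter
        (fun q => effectiveDim q.2 = m + 1), vertexWeight p (t / 2 ^ k) q ≤
          ((N + 1) * ((2 * N + 1) * k) ^ N) * (η * η₀ ^ (t / 2 - 1)) := by
      intro m hm
      refine (Finset.sum_le_card_nsmul _ _ (η ^ (t / 2)) fun q hq => ?_).trans ?_
      · obtain ⟨hq, hd⟩ := Finset.mem_filter.1 hq
        exact vertexWeight_le_of_ne_zero hp0 hle hη0 hother (by linarith) hq (by omega)
      · rw [nsmul_eq_mul]
        refine mul_le_mul ?_ hpow (Real.rpow_nonneg hη0 _) (by positivity)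
        have hc : (((lineParallelotopes k N).filter fun q => effectiveDim q.2 = m + 1).card : ℝ) ≤
            (N + 1) * ((2 * N + 1) * k) ^ (m + 1) := by
          exact_mod_cast card_effectiveDim_eq_le k N (m + 1)
        refine hc.trans (mul_le_mul_of_nonneg_left (pow_le_pow_right₀ ?_
          (Finset.mem_range.1 hm)) (by positivity))
        have : (0 : ℝ) ≤ N := N.cast_nonneg
        nlinarith
    have h2 := Finset.sum_le_sum h1
    rw [Finset.sum_const, Finset.card_range, nsmul_eq_mul] at h2
    have h3 := mul_le_mul_of_nonneg_left hconc hη0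
    linarith
  · push Not at hmax
    have h0 := sum_rpow_le hp0 hsum.le (μ := 1 - η₀) (by linarith) hmax (by linarith : 1 ≤ t)
    -- For N = 0 the only point has mass 1, which exceeds 1 - η₀.
    rcases Nat.eq_zero_or_pos N with rfl | hN
    · have h1 := hmax 0 (by simp)
      simp only [CharP.cast_eq_zero, Finset.Icc_self, Finset.sum_singleton] at hsum
      linarith
    obtain ⟨M, rfl⟩ := Nat.exists_eq_add_of_le' hN
    rw [Nat.add_sub_cancel] at hspread
    rw [Finset.sum_range_succ]
    have hbd : ∀ (m : ℕ) (c : ℝ), (((lineParallelotopes k (M + 1)).filter fun q =>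
        effectiveDim q.2 = m).card : ℝ) ≤ c → ∑ q ∈ (lineParallelotopes k (M + 1)).filter
        (fun q => effectiveDim q.2 = m), vertexWeight p (t / 2 ^ k) q ≤
          c * (2 : ℝ) ^ (-(t * binomialEntropy m)) := by
      intro m c hc
      refine (Finset.sum_le_card_nsmul _ _ ((2 : ℝ) ^ (-(t * binomialEntropy m)))
        fun q hq => ?_).trans ?_
      · obtain ⟨hq', rfl⟩ := Finset.mem_filter.1 hq
        exact vertexWeight_le_entropy hp hsum.le (by linarith) hq'
      · rw [nsmul_eq_mul]
        exact mul_le_mul_of_nonneg_right hc (by positivity)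
    have h1 := Finset.sum_le_sum fun m (_ : m ∈ Finset.range M) => hbd (m + 1)
      (((M + 1 : ℕ) + 1) * ((2 * (M + 1 : ℕ) + 1) * k) ^ (m + 1))
      (by exact_mod_cast card_effectiveDim_eq_le k (M + 1) (m + 1))
    have h2 := hbd (M + 1) (k.choose (M + 1) * 2 ^ (M + 1))
      (by exact_mod_cast card_effectiveDim_eq_top_le k (M + 1))
    linarith

/-- Both sides are homogeneous of degree t in p, which removes the normalisation. Zero values are
reached by adding c > 0 and letting c tend to 0. -/
theorem sum_vertexWeight_le_of_nonneg (ht : 0 < t)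
    (h1 : ∀ p : ℤ → ℝ, (∀ x ∈ Finset.Icc 0 (N : ℤ), 0 < p x) →
      ∑ x ∈ Finset.Icc 0 (N : ℤ), p x = 1 →
      ∑ q ∈ lineParallelotopes k N, vertexWeight p (t / 2 ^ k) q ≤ 1)
    (hp : ∀ x, 0 ≤ p x) :
    ∑ q ∈ lineParallelotopes k N, vertexWeight p (t / 2 ^ k) q ≤
      (∑ x ∈ Finset.Icc 0 (N : ℤ), p x) ^ t := by
  have hs : 0 ≤ t / 2 ^ k := by positivity
  have hpos : ∀ p : ℤ → ℝ, (∀ x, 0 < p x) →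
      ∑ q ∈ lineParallelotopes k N, vertexWeight p (t / 2 ^ k) q ≤
        (∑ x ∈ Finset.Icc 0 (N : ℤ), p x) ^ t := by
    intro p hp
    set S := ∑ x ∈ Finset.Icc 0 (N : ℤ), p x with hS
    have hS0 : 0 < S := Finset.sum_pos (fun x _ => hp x) ⟨0, by simp⟩
    have h := h1 (fun x => p x / S) (fun x _ => div_pos (hp x) hS0)
      (by rw [← Finset.sum_div, ← hS, div_self hS0.ne'])
    have e : ∀ q : ℤ × (Fin k → ℤ), vertexWeight (fun x => p x / S) (t / 2 ^ k) q =
        vertexWeight p (t / 2 ^ k) q / S ^ t := by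
      intro q
      unfold vertexWeight
      simp_rw [fun x => Real.div_rpow (hp x).le hS0.le (t / 2 ^ k)]
      rw [Finset.prod_div_distrib, Finset.prod_const,
        ← Real.rpow_natCast (S ^ (t / 2 ^ k)), ← Real.rpow_mul hS0.le]
      congr 2
      simp
    simp_rw [e] at h
    rwa [← Finset.sum_div, div_le_one (Real.rpow_pos_of_pos hS0 _)] at h
  have hcl : Continuous fun c : ℝ => ∑ q ∈ lineParallelotopes k N,
      vertexWeight (fun x => p x + c) (t / 2 ^ k) q := by
    unfold vertexWeight
    exact continuous_finsetSum _ fun q _ => continuous_finsetProd _ fun ε _ =>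
      (continuous_const.add continuous_id).rpow_const fun _ => Or.inr hs
  have hcr : Continuous fun c : ℝ => (∑ x ∈ Finset.Icc 0 (N : ℤ), (p x + c)) ^ t :=
    (continuous_finsetSum _ fun x _ => continuous_const.add continuous_id).rpow_const
      fun _ => Or.inr ht.le
  have hlim := le_of_tendsto_of_tendsto
    ((hcl.tendsto 0).mono_left (nhdsWithin_le_nhds (s := Set.Ioi 0)))
    ((hcr.tendsto 0).mono_left nhdsWithin_le_nhds)
    (eventually_nhdsWithin_of_forall fun c hc => hpos _ fun x => add_pos_of_nonneg_of_pos (hp x) hc)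
  simpa using hlim

theorem boxBound_Icc (ht : 0 < t)
    (h1 : ∀ p : ℤ → ℝ, (∀ x ∈ Finset.Icc 0 (N : ℤ), 0 < p x) →
      ∑ x ∈ Finset.Icc 0 (N : ℤ), p x = 1 →
      ∑ q ∈ lineParallelotopes k N, vertexWeight p (t / 2 ^ k) q ≤ 1) :
    BoxBound k (t / 2 ^ k) (Finset.Icc 0 (N : ℤ) : Set ℤ) := by
  have hs : 0 < t / 2 ^ k := by positivity
  refine boxBound_of_const fun f hf => ?_
  rw [mul_div_cancel₀ _ (by positivity)]
  have hsum : ∑' x, f x ^ (t / 2 ^ k)⁻¹ = ∑ x ∈ Finset.Icc 0 (N : ℤ), f x ^ (t / 2 ^ k)⁻¹ :=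
    tsum_eq_sum fun x hx => by
      rw [hf x hx, ENNReal.zero_rpow_of_pos (inv_pos.2 hs)]
  by_cases htop : ∃ x, f x = ⊤
  · obtain ⟨x, hx⟩ := htop
    have : ∑' x, f x ^ (t / 2 ^ k)⁻¹ = ⊤ := ENNReal.tsum_eq_top_of_eq_top
      ⟨x, by rw [hx, ENNReal.top_rpow_of_pos (inv_pos.2 hs)]⟩
    rw [this, ENNReal.top_rpow_of_pos ht]
    exact le_top
  push Not at htop
  -- The substitution p = f^{1/s} turns the ℓ^{1/s} norm of f into the total mass of p.
  have h := sum_vertexWeight_le_of_nonneg (p := fun x => (f x ^ (t / 2 ^ k)⁻¹).toReal) ht h1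
    fun x => ENNReal.toReal_nonneg
  have hfin : ∀ x, f x ^ (t / 2 ^ k)⁻¹ ≠ ⊤ := fun x =>
    ENNReal.rpow_ne_top_of_nonneg (inv_pos.2 hs).le (htop x)
  have hbox : boxForm k (fun _ => f) = ∑ q ∈ lineParallelotopes k N,
      ∏ ε : Fin k → Fin 2, f (q.1 + ∑ i, (ε i : ℕ) • q.2 i) := by
    refine tsum_eq_sum fun q hq => ?_
    rw [mem_lineParallelotopes, not_forall] at hq
    obtain ⟨ε, hε⟩ := hq
    exact Finset.prod_eq_zero (Finset.mem_univ ε) (hf _ hε)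
  rw [hbox, hsum]
  have e1 : ∑ q ∈ lineParallelotopes k N, vertexWeight
      (fun x => (f x ^ (t / 2 ^ k)⁻¹).toReal) (t / 2 ^ k) q =
      (∑ q ∈ lineParallelotopes k N,
        ∏ ε : Fin k → Fin 2, f (q.1 + ∑ i, (ε i : ℕ) • q.2 i)).toReal := by
    rw [ENNReal.toReal_sum fun q _ => ENNReal.prod_ne_top fun ε _ => htop _]
    refine Finset.sum_congr rfl fun q _ => ?_
    rw [ENNReal.toReal_prod]
    refine Finset.prod_congr rfl fun ε _ => ?_
    rw [ENNReal.toReal_rpow, ENNReal.rpow_inv_rpow hs.ne']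
  rw [e1, ← ENNReal.toReal_sum fun x _ => hfin x, ENNReal.toReal_rpow] at h
  rwa [ENNReal.toReal_le_toReal] at h
  · exact ENNReal.sum_ne_top.2 fun q _ => ENNReal.prod_ne_top fun ε _ => htop _
  · exact ENNReal.rpow_ne_top_of_nonneg ht.le (ENNReal.sum_ne_top.2 fun x _ => hfin x)

end

/-! ### The lower bound: balanced sequences of sign patterns. -/

section
variable {k : ℕ}

/-- The direction vector of a sign pattern `(I, J)`: it is `-1` on `J` and `1` on `I \ J`. -/
def signVector (s : Σ _ : Finset (Fin k), Finset (Fin k)) (i : Fin k) : ℤ :=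
  if i ∈ s.1 then if i ∈ s.2 then -1 else 1 else 0

/-- Reflection of a sign pattern in the directions selected by `ε`. -/
def reflectPattern (ε : Fin k → Fin 2) (s : Σ _ : Finset (Fin k), Finset (Fin k)) :
    Σ _ : Finset (Fin k), Finset (Fin k) :=
  ⟨s.1, symmDiff s.2 (s.1.filter fun i => ε i = 1)⟩

theorem reflectPattern_involutive (ε : Fin k → Fin 2) :
    Function.Involutive (reflectPattern ε) := fun s => by
  simp [reflectPattern]

theorem reflectPattern_mem {N : ℕ} (ε : Fin k → Fin 2)
    {s : Σ _ : Finset (Fin k), Finset (Fin k)} (hs : s ∈ signPatterns k N) :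
    reflectPattern ε s ∈ signPatterns k N := by
  obtain ⟨h1, h2⟩ := Finset.mem_sigma.1 hs
  refine Finset.mem_sigma.2 ⟨h1, Finset.mem_powerset.2 fun i hi => ?_⟩
  have h2 := Finset.mem_powerset.1 h2
  rcases Finset.mem_symmDiff.1 hi with ⟨h, -⟩ | ⟨h, -⟩
  · exact h2 h
  · exact (Finset.mem_filter.1 h).1

/-- Moving along direction i flips the sign of i: a minus sign (step -1) is lost or gained (step
+1). Hence each vertex is again the number of minus signs of a pattern. -/
theorem card_add_sum_signVector {N : ℕ} (ε : Fin k → Fin 2)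
    {s : Σ _ : Finset (Fin k), Finset (Fin k)} (hs : s ∈ signPatterns k N) :
    (s.2.card : ℤ) + ∑ i, (ε i : ℕ) • signVector s i = ((reflectPattern ε s).2.card : ℤ) := by
  have hsub := Finset.mem_powerset.1 (Finset.mem_sigma.1 hs).2
  have hcard : ∀ T : Finset (Fin k), (T.card : ℤ) = ∑ i, if i ∈ T then (1 : ℤ) else 0 := by
    intro T; simp
  rw [hcard, hcard, ← Finset.sum_add_distrib]
  refine Finset.sum_congr rfl fun i _ => ?_
  have hI := @hsub i
  simp only [reflectPattern, signVector, Finset.mem_symmDiff, Finset.mem_filter]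
  have hε : ε i = 0 ∨ ε i = 1 := by omega
  by_cases hi : i ∈ s.1 <;> by_cases hj : i ∈ s.2 <;> rcases hε with h | h <;> simp_all

theorem signVector_injective {N : ℕ} {s s' : Σ _ : Finset (Fin k), Finset (Fin k)}
    (hs : s ∈ signPatterns k N) (hs' : s' ∈ signPatterns k N)
    (h : signVector s = signVector s') : s = s' := by
  have hsub := Finset.mem_powerset.1 (Finset.mem_sigma.1 hs).2
  have hsub' := Finset.mem_powerset.1 (Finset.mem_sigma.1 hs').2
  obtain ⟨I, J⟩ := s
  obtain ⟨I', J'⟩ := s'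
  have key : ∀ i, (i ∈ I ↔ i ∈ I') ∧ (i ∈ J ↔ i ∈ J') := by
    intro i
    have h1 := congrFun h i
    have h2 := @hsub i
    have h3 := @hsub' i
    simp only [signVector] at h1 h2 h3
    split_ifs at h1 <;> simp_all
  have e1 : I = I' := Finset.ext fun i => (key i).1
  have e2 : J = J' := Finset.ext fun i => (key i).2
  rw [e1, e2]

theorem sum_signPatterns {N : ℕ} (f : ℕ → ℝ) :
    ∑ s ∈ signPatterns k N, f s.2.card =
      k.choose N * ∑ j ∈ Finset.range (N + 1), (N.choose j : ℝ) * f j := by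
  rw [signPatterns, Finset.sum_sigma,
    Finset.sum_congr rfl (g := fun _ => ∑ j ∈ Finset.range (N + 1), (N.choose j : ℝ) * f j)]
  · simp
  · intro I hI
    rw [Finset.sum_powerset_apply_card f, (Finset.mem_powersetCard.1 hI).2]
    simp

end

/-- The functions all of whose fibres have `L` elements. -/
noncomputable def balancedFunctions (d L : ℕ) (S : Type*) [Fintype S] [DecidableEq S] :
    Finset (Fin d → S) :=
  Finset.univ.filter fun φ => ∀ s, (Finset.univ.filter fun c => φ c = s).card = L

/-- Orbit–stabiliser: permutations of the coordinates act on one balanced function, and each fibre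
of the orbit map injects into its stabiliser, of order L!^|S|. -/
theorem factorial_le_card_balancedFunctions {d L : ℕ} {S : Type*} [Fintype S] [DecidableEq S]
    (hd : d = L * Fintype.card S) :
    d.factorial ≤ L.factorial ^ Fintype.card S * (balancedFunctions d L S).card := by
  let e : Fin d ≃ Fin L × S := Fintype.equivOfCardEq (by simp [hd])
  let φ₀ : Fin d → S := fun c => (e c).2
  have hφ₀ : ∀ s, (Finset.univ.filter fun c => φ₀ c = s).card = L := by
    intro s
    rw [← Fintype.card_fin L, ← Finset.card_univ]
    refine Finset.card_bij' (fun c _ => (e c).1) (fun l _ => e.symm (l, s)) ?_ ?_ ?_ ?_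
    · intro c _; exact Finset.mem_univ _
    · intro l _; simp [φ₀]
    · intro c hc
      obtain rfl : (e c).2 = s := (Finset.mem_filter.1 hc).2
      simp
    · intro l _; simp
  have hstab : Fintype.card {g : Equiv.Perm (Fin d) // φ₀ ∘ g = φ₀} =
      L.factorial ^ Fintype.card S := by
    rw [DomMulAct.stabilizer_card φ₀, Finset.prod_congr rfl (g := fun _ => L.factorial)]
    · simp
    · intro s _
      rw [Fintype.card_subtype, hφ₀]
  have h := Finset.card_le_mul_card_image_of_maps_to
    (s := (Finset.univ : Finset (Equiv.Perm (Fin d)))) (t := balancedFunctions d L S)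
    (f := fun g : Equiv.Perm (Fin d) => φ₀ ∘ g) (fun g _ => ?_)
    (L.factorial ^ Fintype.card S) (fun φ _ => ?_)
  · rwa [Finset.card_univ, Fintype.card_perm, Fintype.card_fin] at h
  · refine Finset.mem_filter.2 ⟨Finset.mem_univ _, fun s => ?_⟩
    rw [← hφ₀ s]
    refine Finset.card_bij (fun c _ => g c) ?_ ?_ ?_
    · intro c hc; simpa using hc
    · intro a _ b _ hab; exact g.injective hab
    · intro c hc
      exact ⟨g.symm c, by simpa using hc, by simp⟩
  · rcases (Finset.univ.filter fun g : Equiv.Perm (Fin d) => φ₀ ∘ g = φ).eq_empty_or_nonempty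
      with h0 | ⟨g₀, hg₀⟩
    · rw [h0]; simp
    · have hg₀ : φ₀ ∘ g₀ = φ := (Finset.mem_filter.1 hg₀).2
      rw [← hstab, Fintype.card_subtype]
      refine Finset.card_le_card_of_injOn (fun g => g * g₀⁻¹) ?_ ?_
      · intro g hg
        have hg : φ₀ ∘ g = φ := by simpa using hg
        simp only [Finset.coe_filter, Finset.mem_univ, true_and, Set.mem_ofPred_eq]
        funext c
        have := congrFun (hg.trans hg₀.symm) (g₀⁻¹ c)
        simpa using this
      · intro a _ b _ hab
        exact mul_right_cancel hab

theorem comp_mem_balancedFunctions {d L : ℕ} {S : Type*} [Fintype S] [DecidableEq S]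
    {φ : Fin d → S} (hφ : φ ∈ balancedFunctions d L S) (π : Equiv.Perm S) :
    (fun c => π (φ c)) ∈ balancedFunctions d L S := by
  refine Finset.mem_filter.2 ⟨Finset.mem_univ _, fun s => ?_⟩
  rw [← (Finset.mem_filter.1 hφ).2 (π.symm s)]
  congr 1
  ext c
  simp [Equiv.eq_symm_apply]

theorem prod_comp_of_mem_balancedFunctions {d L : ℕ} {S : Type*} [Fintype S] [DecidableEq S]
    {φ : Fin d → S} (hφ : φ ∈ balancedFunctions d L S) (f : S → ℝ) :
    ∏ c, f (φ c) = (∏ s, f s) ^ L := by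
  rw [← Finset.prod_pow, ← Finset.prod_fiberwise (g := φ)]
  refine Finset.prod_congr rfl fun s _ => ?_
  rw [Finset.prod_congr rfl (g := fun _ => f s) fun c hc => by rw [(Finset.mem_filter.1 hc).2],
    Finset.prod_const, (Finset.mem_filter.1 hφ).2 s]

/-- The set of vectors whose coordinates are the numbers of minus signs of a balanced sequence of
sign patterns. -/
noncomputable def balancedVectors (k N d L : ℕ) : Finset (Fin d → ℤ) :=
  (balancedFunctions d L (signPatterns k N)).image fun φ c => ((φ c).1.2.card : ℤ)

/-- Reflecting by ε permutes the sign patterns, so it preserves balance; every vertex of the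
parallelotope attached to a balanced sequence thus lies in `balancedVectors`. -/
theorem card_balancedFunctions_le_energy (k N d L : ℕ) :
    (balancedFunctions d L (signPatterns k N)).card ≤
      parallelotopeEnergy k (balancedVectors k N d L) := by
  rw [parallelotopeEnergy, ← Set.ncard_coe_finset]
  refine Set.ncard_le_ncard_of_injOn
    (fun φ => (fun c => ((φ c).1.2.card : ℤ), fun i c => signVector (φ c).1 i)) ?_ ?_
    (parallelotopes_finite _ _)
  · intro φ hφ ε
    let π : Equiv.Perm (signPatterns k N) := Function.Involutive.toPerm
      (fun s => ⟨reflectPattern ε s.1, reflectPattern_mem ε s.2⟩)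
      (fun s => Subtype.ext (reflectPattern_involutive ε s.1))
    refine Finset.mem_image.2 ⟨_, comp_mem_balancedFunctions (Finset.mem_coe.1 hφ) π, ?_⟩
    funext c
    simp only [Pi.add_apply, Finset.sum_apply, Pi.smul_apply]
    exact (card_add_sum_signVector ε (φ c).2).symm
  · intro φ _ φ' _ h
    funext c
    refine Subtype.ext (signVector_injective (φ c).2 (φ' c).2 (funext fun i => ?_))
    exact congrFun (congrFun (congrArg Prod.snd h) i) c

theorem balancedVectors_mem {k N d L : ℕ} {x : Fin d → ℤ} (hx : x ∈ balancedVectors k N d L)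
    (c : Fin d) : x c ∈ Finset.Icc 0 (N : ℤ) := by
  obtain ⟨φ, -, rfl⟩ := Finset.mem_image.1 hx
  obtain ⟨h1, h2⟩ := Finset.mem_sigma.1 (φ c).2
  have := Finset.card_le_card (Finset.mem_powerset.1 h2)
  rw [(Finset.mem_powersetCard.1 h1).2] at this
  simp only [Finset.mem_Icc]
  omega

/-- Every vector of the set has the same probability 2^(-d H_N) under the product of d copies of
B(N,1/2), and these probabilities sum to at most 1. -/
theorem card_balancedVectors_le (k N L : ℕ) {d : ℕ} (hd : d = L * (k.choose N * 2 ^ N)) :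
    ((balancedVectors k N d L).card : ℝ) ≤ (2 : ℝ) ^ (d * binomialEntropy N) := by
  let p : ℕ → ℝ := fun j => (N.choose j : ℝ) / 2 ^ N
  have hp0 : ∀ j, 0 ≤ p j := fun j => by positivity
  have hpos : ∀ s : signPatterns k N, 0 < p s.1.2.card := by
    intro s
    obtain ⟨h1, h2⟩ := Finset.mem_sigma.1 s.2
    have := Finset.card_le_card (Finset.mem_powerset.1 h2)
    rw [(Finset.mem_powersetCard.1 h1).2] at this
    have : 0 < N.choose s.1.2.card := Nat.choose_pos this
    simp only [p]
    positivity
  have hprod : ∏ s : signPatterns k N, p s.1.2.card =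
      (2 : ℝ) ^ (-(k.choose N * 2 ^ N * binomialEntropy N)) := by
    have e : ∀ s : signPatterns k N, p s.1.2.card = (2 : ℝ) ^ Real.logb 2 (p s.1.2.card) :=
      fun s => (Real.rpow_logb two_pos (by norm_num) (hpos s)).symm
    rw [Finset.prod_congr rfl fun s _ => e s, ← Real.rpow_sum_of_pos two_pos]
    congr 1
    rw [Finset.sum_coe_sort (signPatterns k N) fun s => Real.logb 2 (p s.2.card),
      sum_signPatterns fun j => Real.logb 2 (p j), binomialEntropy]
    rw [mul_neg, neg_neg, mul_assoc, Finset.mul_sum _ _ (2 ^ N : ℝ)]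
    congr 1
    refine Finset.sum_congr rfl fun j _ => ?_
    simp only [p]
    field_simp
  have hweight : ∀ x ∈ balancedVectors k N d L, ∏ c, p (x c).toNat =
      (2 : ℝ) ^ (-(d * binomialEntropy N)) := by
    intro x hx
    obtain ⟨φ, hφ, rfl⟩ := Finset.mem_image.1 hx
    simp only [Int.toNat_natCast]
    rw [prod_comp_of_mem_balancedFunctions hφ fun s => p s.1.2.card, hprod, ← Real.rpow_natCast,
      ← Real.rpow_mul zero_le_two, hd]
    congr 1
    push_cast
    ring
  have hle : ∑ x ∈ balancedVectors k N d L, ∏ c, p (x c).toNat ≤ 1 := by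
    calc _ ≤ ∑ x ∈ Fintype.piFinset fun _ : Fin d => Finset.Icc 0 (N : ℤ), ∏ c, p (x c).toNat :=
          Finset.sum_le_sum_of_subset_of_nonneg
            (fun x hx => Fintype.mem_piFinset.2 (balancedVectors_mem hx))
            fun x _ _ => Finset.prod_nonneg fun c _ => hp0 _
      _ = ∏ _c : Fin d, ∑ z ∈ Finset.Icc 0 (N : ℤ), p z.toNat :=
          (Finset.prod_univ_sum (fun _ => Finset.Icc 0 (N : ℤ)) fun _ z => p z.toNat).symm
      _ = 1 := by
          have : ∑ z ∈ Finset.Icc 0 (N : ℤ), p z.toNat = 1 := by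
            have h1 : ∑ j ∈ Finset.range (N + 1), p j = 1 := by
              simp only [p]
              rw [← Finset.sum_div, sum_range_choose_real, div_self (by positivity)]
            rw [← h1]
            refine Finset.sum_bij' (fun z _ => z.toNat) (fun j _ => (j : ℤ)) ?_ ?_ ?_ ?_ ?_
            · intro z hz; simp only [Finset.mem_Icc, Finset.mem_range] at hz ⊢; omega
            · intro j hj; simp only [Finset.mem_Icc, Finset.mem_range] at hj ⊢; omega
            · intro z hz; simp only [Finset.mem_Icc] at hz; omega
            · intro j _; simp
            · intro z _; rfl
          simp [this]
  rw [Finset.sum_congr rfl hweight, Finset.sum_const, nsmul_eq_mul, Real.rpow_neg zero_le_two,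
    ← div_eq_mul_inv, div_le_one (by positivity)] at hle
  exact hle

theorem factorial_le_of_pos {L : ℕ} (hL : 0 < L) :
    (L.factorial : ℝ) ≤ Real.exp 1 * L * (L / Real.exp 1) ^ L := by
  obtain ⟨m, rfl⟩ := Nat.exists_eq_add_of_le' hL
  have h := Stirling.stirlingSeq'_antitone (Nat.zero_le m)
  simp only [Function.comp, Nat.succ_eq_add_one, zero_add, Stirling.stirlingSeq_one] at h
  unfold Stirling.stirlingSeq at h
  have hL1 : (1 : ℝ) ≤ (m + 1 : ℕ) := by exact_mod_cast hL
  rw [div_le_iff₀ (by positivity), Real.sqrt_mul zero_le_two] at h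
  refine h.trans ?_
  have e : Real.exp 1 / √2 * (√2 * √((m + 1 : ℕ) : ℝ) * (((m + 1 : ℕ) : ℝ) / Real.exp 1) ^ (m + 1)) =
      Real.exp 1 * √((m + 1 : ℕ) : ℝ) * (((m + 1 : ℕ) : ℝ) / Real.exp 1) ^ (m + 1) := by
    have : √(2 : ℝ) ≠ 0 := by positivity
    field_simp
  rw [e]
  have : √((m + 1 : ℕ) : ℝ) ≤ (m + 1 : ℕ) := Real.sqrt_le_iff.2 ⟨by positivity, by nlinarith⟩
  gcongr

theorem le_one_of_forall_pow_le {r C : ℝ} (h : ∀ L : ℕ, 0 < L → r ^ L ≤ C * L) : r ≤ 1 := by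
  by_contra! hr
  have hlim := (tendsto_pow_const_div_const_pow_of_one_lt 1 hr).const_mul C
  rw [mul_zero] at hlim
  obtain ⟨L, hL, hL0⟩ := ((hlim.eventually_lt_const one_pos).and (eventually_gt_atTop 0)).exists
  have hp : 0 < r ^ L := by positivity
  rw [pow_one, ← mul_div_assoc, div_lt_one hp] at hL
  exact absurd (h L hL0) (not_le.2 hL)

theorem logb_le_of_mem_admissibleExponents {k N : ℕ} (hN : N ≤ k) {t : ℝ}
    (ht : t ∈ admissibleExponents k (N + 1)) :
    Real.logb 2 (k.choose N * 2 ^ N) ≤ t * binomialEntropy N := by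
  obtain ⟨ht0, ht⟩ := ht
  set M := k.choose N * 2 ^ N with hM
  have hM0 : 0 < M := Nat.mul_pos (Nat.choose_pos hN) (by positivity)
  have hM0' : (0 : ℝ) < M := by exact_mod_cast hM0
  set B : ℝ := (2 : ℝ) ^ (t * binomialEntropy N) with hB
  have hB0 : 0 < B := by positivity
  -- Stirling's bounds leave (M/B)^L ≤ e L for every L > 0 after taking an M-th root; exponential
  -- growth excludes M/B > 1.
  suffices h : (M : ℝ) / B ≤ 1 by
    rw [div_le_one hB0] at h
    rw [Real.logb_le_iff_le_rpow one_lt_two (by exact_mod_cast hM0)]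
    have e : (M : ℝ) = k.choose N * 2 ^ N := by rw [hM]; push_cast; ring
    rwa [← e]
  refine le_one_of_forall_pow_le (C := Real.exp 1) fun L hL => ?_
  have hL' : (0 : ℝ) < L := by exact_mod_cast hL
  have hd : 0 < L * M := Nat.mul_pos hL hM0
  have hcardS : Fintype.card (signPatterns k N) = M := by
    rw [Fintype.card_coe, card_signPatterns]
  have h1 := ht (L * M) hd (balancedVectors k N (L * M) L) fun a ha i => by
    have := Finset.mem_Icc.1 (balancedVectors_mem ha i)
    push_cast
    omega
  have h2 : ((balancedVectors k N (L * M) L).card : ℝ) ^ t ≤ B ^ (L * M) := by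
    refine (Real.rpow_le_rpow (by positivity) (card_balancedVectors_le k N L rfl) ht0.le).trans
      (le_of_eq ?_)
    rw [← Real.rpow_mul zero_le_two, hB, ← Real.rpow_natCast, ← Real.rpow_mul zero_le_two]
    congr 1
    ring
  have h3 : ((balancedFunctions (L * M) L (signPatterns k N)).card : ℝ) ≤
      parallelotopeEnergy k (balancedVectors k N (L * M) L) := by
    exact_mod_cast card_balancedFunctions_le_energy k N (L * M) L
  have h4 : ((L * M).factorial : ℝ) ≤
      (L.factorial : ℝ) ^ M * (balancedFunctions (L * M) L (signPatterns k N)).card := by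
    have := factorial_le_card_balancedFunctions (d := L * M) (L := L) (S := signPatterns k N)
      (by rw [hcardS])
    rw [hcardS] at this
    exact_mod_cast this
  have h5 : (((L * M : ℕ) : ℝ) / Real.exp 1) ^ (L * M) ≤ ((L * M).factorial : ℝ) := by
    refine le_trans (le_mul_of_one_le_left (by positivity) ?_)
      (Stirling.le_factorial_stirling (L * M))
    rw [Real.one_le_sqrt]
    have h1 : (1 : ℝ) ≤ (L * M : ℕ) := by exact_mod_cast hd
    nlinarith [Real.pi_gt_three]
  have h6 : (((L * M : ℕ) : ℝ) / Real.exp 1) ^ (L * M) ≤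
      (Real.exp 1 * L * (L / Real.exp 1) ^ L) ^ M * B ^ (L * M) :=
    calc _ ≤ (L.factorial : ℝ) ^ M * (balancedFunctions (L * M) L (signPatterns k N)).card :=
          h5.trans h4
      _ ≤ _ := mul_le_mul (pow_le_pow_left₀ (by positivity) (factorial_le_of_pos hL) M)
          ((h3.trans h1).trans h2) (by positivity) (by positivity)
  rw [pow_mul _ L M, pow_mul B L M, ← mul_pow,
    pow_le_pow_iff_left₀ (by positivity) (by positivity) hM0.ne'] at h6
  have e : (((L * M : ℕ) : ℝ) / Real.exp 1) ^ L = (M / B) ^ L * ((L / Real.exp 1) ^ L * B ^ L) := by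
    rw [← mul_pow, ← mul_pow]
    congr 1
    push_cast
    field_simp
  rw [e, mul_assoc (Real.exp 1 * L)] at h6
  exact le_of_mul_le_mul_right h6 (by positivity)

/-! ### Trivial bounds and attainment of the infimum. -/

theorem parallelotopeEnergy_le_pow (k : ℕ) {d : ℕ} (A : Finset (Fin d → ℤ)) :
    parallelotopeEnergy k A ≤ A.card ^ (k + 1) := by
  have hcard : (A ×ˢ Fintype.piFinset fun _ : Fin k => A).card = A.card ^ (k + 1) := by
    rw [Finset.card_product, Fintype.card_piFinset_const, pow_succ, mul_comm]
  rw [parallelotopeEnergy, ← hcard, ← Set.ncard_coe_finset]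
  refine Set.ncard_le_ncard_of_injOn (fun p => (p.1, fun i => p.1 + p.2 i)) ?_ ?_
    (Finset.finite_toSet _)
  · intro p hp
    refine Finset.mem_coe.2 (Finset.mem_product.2 ⟨by simpa using hp 0,
      Fintype.mem_piFinset.2 fun i => ?_⟩)
    have h := hp (Pi.single i 1)
    rw [Finset.sum_eq_single i (fun j _ hj => by simp [Pi.single_eq_of_ne hj]) (by simp)] at h
    simpa using h
  · rintro ⟨a, h⟩ _ ⟨a', h'⟩ _ heq
    simp only [Prod.mk.injEq] at heq
    obtain ⟨rfl, heq⟩ := heq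
    exact Prod.ext rfl (funext fun i => by simpa using congrFun heq i)

theorem card_le_parallelotopeEnergy (k : ℕ) {d : ℕ} (A : Finset (Fin d → ℤ)) :
    A.card ≤ parallelotopeEnergy k A := by
  rw [parallelotopeEnergy, ← Set.ncard_coe_finset]
  refine Set.ncard_le_ncard_of_injOn (fun a => (a, 0)) (fun a ha ε => ?_)
    (fun a _ b _ h => congrArg Prod.fst h) (parallelotopes_finite k A)
  simpa using ha

theorem succ_mem_admissibleExponents (k n : ℕ) : (k : ℝ) + 1 ∈ admissibleExponents k n := by
  refine ⟨by positivity, fun d _ A _ => ?_⟩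
  have := parallelotopeEnergy_le_pow k A
  rw [← Nat.cast_add_one, Real.rpow_natCast]
  exact_mod_cast this

theorem one_le_of_mem_admissibleExponents {k n : ℕ} (hn : 2 ≤ n) {t : ℝ}
    (ht : t ∈ admissibleExponents k n) : 1 ≤ t := by
  have h := ht.2 1 one_pos {0, 1} (fun a ha i => by
    rcases Finset.mem_insert.1 ha with rfl | ha
    · simp; omega
    · rw [Finset.mem_singleton.1 ha]; simp; omega)
  have h2 : ((({0, 1} : Finset (Fin 1 → ℤ)).card : ℕ) : ℝ) ≤
      parallelotopeEnergy k ({0, 1} : Finset (Fin 1 → ℤ)) := by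
    exact_mod_cast card_le_parallelotopeEnergy k _
  have hc : (({0, 1} : Finset (Fin 1 → ℤ)).card) = 2 := Finset.card_pair zero_ne_one
  have h3 := h2.trans h
  rw [hc, Nat.cast_ofNat] at h3
  by_contra! hlt
  have := Real.rpow_lt_rpow_of_exponent_lt one_lt_two hlt
  rw [Real.rpow_one] at this
  linarith

theorem bddBelow_admissibleExponents (k n : ℕ) : BddBelow (admissibleExponents k n) :=
  ⟨0, fun _ ht => ht.1.le⟩

theorem isLeast_optimalExponent {k n : ℕ} (hn : 2 ≤ n) :
    IsLeast (admissibleExponents k n) (optimalExponent k n) := by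
  have hne : (admissibleExponents k n).Nonempty := ⟨_, succ_mem_admissibleExponents k n⟩
  have hbdd := bddBelow_admissibleExponents k n
  have hpos : 0 < optimalExponent k n :=
    one_pos.trans_le (le_csInf hne fun t ht => one_le_of_mem_admissibleExponents hn ht)
  refine ⟨⟨hpos, fun d hd A hA => ?_⟩, fun t ht => csInf_le hbdd ht⟩
  -- For nonempty A the condition on t is closed by continuity of t ↦ |A|^t; for empty A both sides
  -- are 0. The bound 1 ≤ t from a two-point set keeps the infimum positive.
  rcases A.eq_empty_or_nonempty with rfl | hA0
  · have := parallelotopeEnergy_le_pow k (∅ : Finset (Fin d → ℤ))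
    rw [Finset.card_empty, zero_pow (by omega), Nat.le_zero] at this
    rw [this, Finset.card_empty, Nat.cast_zero, Real.zero_rpow hpos.ne']
  · obtain ⟨u, -, hu, hmem⟩ := exists_seq_tendsto_sInf hne hbdd
    have hc : (A.card : ℝ) ≠ 0 := by exact_mod_cast (Finset.card_pos.2 hA0).ne'
    exact ge_of_tendsto' ((Real.continuous_const_rpow hc).tendsto _ |>.comp hu)
      fun j => (hmem j).2 d hd A hA

/-! ### Asymptotics as k tends to infinity. -/

theorem tendsto_pow_mul_two_rpow {m : ℕ} {x : ℝ} (hx : m < x) (y : ℝ) :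
    Tendsto (fun k : ℕ => (k : ℝ) ^ m * (2 : ℝ) ^ (-(x * Real.logb 2 k + y))) atTop (𝓝 0) := by
  have h := ((tendsto_rpow_neg_atTop (sub_pos.2 hx)).comp
    tendsto_natCast_atTop_atTop).mul_const ((2 : ℝ) ^ (-y))
  rw [zero_mul] at h
  refine h.congr' ((eventually_gt_atTop 0).mono fun k hk => ?_)
  have hk' : (0 : ℝ) < k := by exact_mod_cast hk
  have e : (2 : ℝ) ^ (-(x * Real.logb 2 k + y)) = (k : ℝ) ^ (-x) * 2 ^ (-y) := by
    rw [neg_add, Real.rpow_add two_pos, ← neg_mul, mul_comm (-x), Real.rpow_mul zero_le_two,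
      Real.rpow_logb two_pos (by norm_num) hk']
  simp only [Function.comp]
  rw [e, ← mul_assoc, ← Real.rpow_natCast, ← Real.rpow_add hk']
  congr 2
  ring

/-- The asymptotic value of the optimal exponent for subsets of `{0, …, N}^d`. -/
noncomputable def asymptoticExponent (N k : ℕ) : ℝ :=
  (N * Real.logb 2 (2 * (k : ℝ)) - Real.logb 2 (N.factorial : ℝ)) / binomialEntropy N

theorem asymptoticExponent_eq (N : ℕ) {k : ℕ} (hk : 0 < k) :
    asymptoticExponent N k = N / binomialEntropy N * Real.logb 2 k +
      (N - Real.logb 2 (N.factorial : ℝ)) / binomialEntropy N := by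
  have hk' : (k : ℝ) ≠ 0 := by exact_mod_cast hk.ne'
  rw [asymptoticExponent, Real.logb_mul two_ne_zero hk', Real.logb_self_eq_one one_lt_two]
  ring

theorem tendsto_asymptoticExponent {N : ℕ} (hN : 1 ≤ N) :
    Tendsto (asymptoticExponent N) atTop atTop := by
  have hα : 0 < N / binomialEntropy N := div_pos (by exact_mod_cast hN) (binomialEntropy_pos hN)
  refine (tendsto_atTop_add_const_right _ ((N - Real.logb 2 (N.factorial : ℝ)) / binomialEntropy N)
    (((Real.tendsto_logb_atTop one_lt_two).comp
      tendsto_natCast_atTop_atTop).const_mul_atTop hα)).congr' ?_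
  exact (eventually_gt_atTop 0).mono fun k hk => (asymptoticExponent_eq N hk).symm

theorem choose_mul_two_rpow_le {N k : ℕ} (hN : 1 ≤ N) (hk : 0 < k) (δ : ℝ) :
    k.choose N * 2 ^ N * (2 : ℝ) ^ (-((asymptoticExponent N k + δ) * binomialEntropy N)) ≤
      2 ^ (-(δ * binomialEntropy N)) := by
  have hH := binomialEntropy_pos hN
  have hk' : (0 : ℝ) < k := by exact_mod_cast hk
  have hf : (0 : ℝ) < N.factorial := by exact_mod_cast N.factorial_pos
  have e : (2 : ℝ) ^ (-((asymptoticExponent N k + δ) * binomialEntropy N)) =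
      2 ^ (-(δ * binomialEntropy N)) * (N.factorial / (2 * k) ^ N) := by
    have e1 : -((asymptoticExponent N k + δ) * binomialEntropy N) =
        -(δ * binomialEntropy N) +
          Real.logb 2 (N.factorial / (2 * k) ^ N) := by
      rw [Real.logb_div hf.ne' (by positivity), Real.logb_pow, asymptoticExponent]
      field_simp
      ring
    rw [e1, Real.rpow_add two_pos, Real.rpow_logb two_pos (by norm_num) (by positivity)]
  rw [e]
  have hc : (k.choose N : ℝ) ≤ k ^ N / N.factorial := Nat.choose_le_pow_div N k
  rw [le_div_iff₀ hf] at hc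
  have h2 : k.choose N * 2 ^ N * ((N.factorial : ℝ) / (2 * k) ^ N) ≤ 1 := by
    rw [mul_pow, ← mul_div_assoc, div_le_one (by positivity)]
    nlinarith [pow_pos (two_pos : (0 : ℝ) < 2) N]
  calc _ = (2 : ℝ) ^ (-(δ * binomialEntropy N)) *
        (k.choose N * 2 ^ N * ((N.factorial : ℝ) / (2 * k) ^ N)) := by ring
    _ ≤ _ := mul_le_of_le_one_right (by positivity) h2

theorem eventually_mem_admissibleExponents {N : ℕ} (hN : 1 ≤ N) {δ : ℝ} (hδ : 0 < δ) :
    ∀ᶠ k : ℕ in atTop, asymptoticExponent N k + δ ∈ admissibleExponents k (N + 1) := by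
  have hH := binomialEntropy_pos hN
  have hN' : (1 : ℝ) ≤ N := by exact_mod_cast hN
  set H := binomialEntropy N with hHdef
  set α : ℝ := N / H with hα
  set β : ℝ := (N - Real.logb 2 (N.factorial : ℝ)) / H + δ with hβ
  have hα1 : 1 ≤ α := (one_le_div hH).2 (binomialEntropy_le N)
  have ht : ∀ k : ℕ, 0 < k → asymptoticExponent N k + δ = α * Real.logb 2 k + β := fun k hk => by
    rw [asymptoticExponent_eq N hk, hβ]; ring
  have htop : Tendsto (fun k => asymptoticExponent N k + δ) atTop atTop :=
    tendsto_atTop_add_const_right _ _ (tendsto_asymptoticExponent hN)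
  -- With this choice η₀^(t/2 - 1) decays like k^(-2Nα), where α = N/H_N ≥ 1, and so beats the k^N
  -- terms of the concentrated case.
  set η₀ : ℝ := (2 : ℝ) ^ (-(4 * N : ℝ)) with hη₀
  have hη0 : 0 < η₀ := by positivity
  have hη1 : η₀ ≤ 1 / 2 := by
    calc η₀ ≤ (2 : ℝ) ^ (-1 : ℝ) :=
          Real.rpow_le_rpow_of_exponent_le one_le_two (by linarith)
      _ = 1 / 2 := by rw [Real.rpow_neg_one]; norm_num
  have hconc : ∀ᶠ k : ℕ in atTop, N * ((N + 1) * ((2 * N + 1) * k) ^ N) *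
      η₀ ^ ((asymptoticExponent N k + δ) / 2 - 1) ≤ (1 : ℝ) := by
    have h := (tendsto_pow_mul_two_rpow (m := N) (x := 2 * N * α) (by nlinarith)
      (2 * N * β - 4 * N)).const_mul (N * ((N + 1) * (2 * N + 1) ^ N) : ℝ)
    rw [mul_zero] at h
    filter_upwards [h.eventually_le_const one_pos, eventually_gt_atTop 0] with k hk hk0
    refine le_of_eq_of_le ?_ hk
    rw [hη₀, ← Real.rpow_mul zero_le_two, ht k hk0, mul_pow]
    rw [show -(4 * N : ℝ) * ((α * Real.logb 2 k + β) / 2 - 1) =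
      -(2 * N * α * Real.logb 2 k + (2 * N * β - 4 * N)) by ring]
    ring
  have hspread : ∀ᶠ k : ℕ in atTop, ∑ m ∈ Finset.range (N - 1),
      ((N + 1) * ((2 * N + 1) * k) ^ (m + 1)) *
        (2 : ℝ) ^ (-((asymptoticExponent N k + δ) * binomialEntropy (m + 1))) +
      (1 - η₀) ^ ((asymptoticExponent N k + δ) - 1) ≤ 1 - 2 ^ (-(δ * H)) := by
    have hlt : 0 < 1 - (2 : ℝ) ^ (-(δ * H)) := by
      have := Real.rpow_lt_one_of_one_lt_of_neg one_lt_two (neg_neg_of_pos (mul_pos hδ hH))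
      linarith
    have h1 : Tendsto (fun k : ℕ => (1 - η₀) ^ ((asymptoticExponent N k + δ) - 1)) atTop (𝓝 0) :=
      (tendsto_rpow_atTop_of_base_lt_one (1 - η₀) (by linarith) (by linarith)).comp
        (tendsto_atTop_add_const_right _ (-1) htop)
    have h2 : Tendsto (fun k : ℕ => ∑ m ∈ Finset.range (N - 1),
        ((N + 1) * ((2 * N + 1) * k) ^ (m + 1)) *
          (2 : ℝ) ^ (-((asymptoticExponent N k + δ) * binomialEntropy (m + 1)))) atTop (𝓝 0) := by
      rw [← Finset.sum_const_zero (s := Finset.range (N - 1)) (M := ℝ)]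
      refine tendsto_finsetSum _ fun m hm => ?_
      have hmN : m + 1 < N := by have := Finset.mem_range.1 hm; omega
      -- The strict decrease of H_m/m is used here: each intermediate dimension contributes a
      -- negative power of k.
      have hlt : ((m + 1 : ℕ) : ℝ) < α * binomialEntropy (m + 1) := by
        have := mul_binomialEntropy_lt (Nat.le_add_left 1 m) hmN
        rw [hα, div_mul_eq_mul_div, lt_div_iff₀ hH]
        exact this
      have h := (tendsto_pow_mul_two_rpow hlt (β * binomialEntropy (m + 1))).const_mul
        ((N + 1) * (2 * N + 1) ^ (m + 1) : ℝ)
      rw [mul_zero] at h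
      refine h.congr' ((eventually_gt_atTop 0).mono fun k hk => ?_)
      simp only
      rw [ht k hk, mul_pow, show -((α * Real.logb 2 k + β) * binomialEntropy (m + 1)) =
        -(α * binomialEntropy (m + 1) * Real.logb 2 k + β * binomialEntropy (m + 1)) by ring]
      ring
    have h3 := h2.add h1
    rw [add_zero] at h3
    exact h3.eventually_le_const hlt
  filter_upwards [hconc, hspread, htop.eventually_ge_atTop 2, eventually_gt_atTop 0]
    with k h1 h2 h3 hk
  have ht0 : 0 < asymptoticExponent N k + δ := by linarith
  refine ⟨ht0, fun d _ A hA => ?_⟩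
  refine parallelotopeEnergy_le_of_boxBound ht0 (boxBound_Icc (N := N) ht0 fun p hp hsum => ?_) A
    fun a ha i => ?_
  · refine sum_vertexWeight_le_one hp hsum h3 hk hη0 hη1 h1 ?_
    have := choose_mul_two_rpow_le hN hk δ
    linarith
  · have := hA a ha i
    push_cast at this
    rw [Finset.mem_coe, Finset.mem_Icc]
    omega

/-- The lower bound log₂(C(k,N) 2^N)/H_N differs from `asymptoticExponent` by log₂ of the ratio of
C(k,N) to k^N/N!, divided by H_N; that ratio tends to 1. -/
theorem eventually_lt_optimalExponent {N : ℕ} (hN : 1 ≤ N) {a : ℝ} (ha : a < 0) :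
    ∀ᶠ k : ℕ in atTop, a < optimalExponent k (N + 1) - asymptoticExponent N k := by
  have hH := binomialEntropy_pos hN
  have hf : (0 : ℝ) < N.factorial := by exact_mod_cast N.factorial_pos
  have hratio : Tendsto (fun k : ℕ => (k.choose N : ℝ) / (k ^ N / N.factorial)) atTop (𝓝 1) := by
    refine (Asymptotics.isEquivalent_iff_tendsto_one ?_).1 (isEquivalent_choose N)
    filter_upwards [eventually_gt_atTop 0] with k hk
    have hk' : (0 : ℝ) < k := by exact_mod_cast hk
    positivity
  have hlog : Tendsto (fun k : ℕ => Real.logb 2 ((k.choose N : ℝ) / (k ^ N / N.factorial)) /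
      binomialEntropy N) atTop (𝓝 0) := by
    have h := ((Real.continuousAt_logb (b := 2) one_ne_zero).tendsto.comp hratio).div_const
      (binomialEntropy N)
    simpa using h
  filter_upwards [hlog.eventually_const_lt ha, eventually_ge_atTop N, eventually_gt_atTop 0]
    with k hk hkN hk0
  refine hk.trans_le ?_
  have hk' : (0 : ℝ) < k := by exact_mod_cast hk0
  have hc : (0 : ℝ) < k.choose N := by exact_mod_cast Nat.choose_pos hkN
  have hopt := logb_le_of_mem_admissibleExponents hkN
    (isLeast_optimalExponent (k := k) (n := N + 1) (by omega)).1
  rw [asymptoticExponent, div_le_iff₀ hH, sub_mul, div_mul_cancel₀ _ hH.ne']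
  refine le_trans (le_of_eq ?_) (sub_le_sub_right hopt _)
  rw [Real.logb_div hc.ne' (by positivity), Real.logb_div (by positivity) hf.ne',
    Real.logb_mul hc.ne' (by positivity), Real.logb_mul two_ne_zero hk'.ne', Real.logb_pow,
    Real.logb_pow, Real.logb_self_eq_one one_lt_two]
  ring

theorem theorem3 (n : ℕ) (hn : 2 ≤ n) :
    (∀ k : ℕ, 2 ≤ k → IsLeast (admissibleExponents k n) (optimalExponent k n)) ∧
      Tendsto
        (fun k : ℕ => optimalExponent k n -
          (((n : ℝ) - 1) * Real.logb 2 (2 * (k : ℝ)) - Real.logb 2 ((n - 1).factorial : ℝ)) /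
            binomialEntropy (n - 1))
        atTop (𝓝 0) := by
  refine ⟨fun k _ => isLeast_optimalExponent hn, ?_⟩
  obtain ⟨N, rfl⟩ := Nat.exists_eq_add_of_le' (by omega : 1 ≤ n)
  have hN : 1 ≤ N := by omega
  simp only [Nat.add_sub_cancel, Nat.cast_add_one, add_sub_cancel_right]
  change Tendsto (fun k : ℕ => optimalExponent k (N + 1) - asymptoticExponent N k) atTop (𝓝 0)
  refine tendsto_order.2 ⟨fun a ha => eventually_lt_optimalExponent hN ha, fun a ha => ?_⟩
  filter_upwards [eventually_mem_admissibleExponents hN (half_pos ha)] with k hk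
  have : optimalExponent k (N + 1) ≤ _ := (isLeast_optimalExponent hn).2 hk
  linarith
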